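/- Let $n,k,r,t$ be positive integers and let $F=\mathbb{F}_q$ be a finite field. A linear code $\mathcal{C}\subseteq\mathbb{F}_q^n$ of dimension $k$ is an $(n,k,r,t)$ availability code if for every coordinate $i$ there are $t$ pairwise disjoint sets $R^i_1,\dots,R^i_t\subseteq[n]\setminus\{i\}$ with $|R^i_j|\le r$ such that for each $j$ there are $a_\ell\in\mathbb{F}_q$ with $c_i=\sum_{\ell\in R^i_j}a_\ell c_\ell$ for all $c\in\mathcal{C}$. Put $$\rho(r,t)=\frac{r}{r+1}\ (t=1),\quad \frac{r}{r+2}\ (t=2),\quad \frac{r^2}{(r+1)^2}\ (t=3),\quad \prod_{j=1}^t\Bigl(1+\frac1{jr}\Bigr)^{-1}\ (t>3),$$ let $b_1=\lceil n(1-\rho(r,t))\rceil$, and define $e_1,\dots,e_{b_1}$ (the minimum support weight sequence of $(n,b_1,r)$) by $e_{b_1}=n$ and $e_{i-1}=\min\{e_i,\ e_i-\lceil 2e_i/i\rceil+r+1\}$ for $2\le i\le b_1$. Let $S=\{i:\ 1\le i\le b_1,\ e_i-i<k\}$. Write $d^{q}_{\min}(n',k',r,t)$ for the largest minimum distance of an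 $(n',k',r,t)$ availability code over $\mathbb{F}_q$, $d_{\min}(n',k',r,t)$ for the largest minimum distance of an $(n',k',r,t)$ availability code over any finite field, $d^{(q)}(n',k')$ for the largest minimum distance of an $[n',k']$ linear code over $\mathbb{F}_q$, and $k^{(q)}(n',d)$ for the largest dimension of a linear code over $\mathbb{F}_q$ of length $n'$ and minimum distance $d$. A minimum over an empty set is $+\infty$. Let $\mathcal{C}$ be an $(n,k,r,t)$ availability code over $\mathbb{F}_q$ with minimum distance $d$. Then: 1. for all $1\le i\le b_1$, the dual code $\mathcal{C}^\perp$ has an $i$-dimensional subcode, and its $i$-th minimum support weight (the least size of the support of an $i$-dimensional subcode) is at most $e_i$; 2. $$d\le\min_{i\in S}d^{q}_{\min}(n-e_i,\,k+i-e_i,\,r,t)\le\min_{i\in S}d^{(q)}(n-e_i,\,k+i-e_i);$$ 3. $$k\le\min_{1\le i\le b_1,\ e_i<n-d+1}\bigl[e_i-i+k^{(q)}(n-e_i,d)\bigr];$$ 4. $$d_{\min}(n,k,r,t)\le\min_{i\in S}d_{\min}(n-e_i,\,k+i-e_i,\,r,t)\le\min_{i\in S}\Bigl[n-k-i+1-\sum_{j=1}^t\Bigl\lfloor\frac{k+i-e_i-1}{r^j}\Bigr\rfloor\Bigr].$$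 -/

import Mathlib

namespace AvailCode

/-- The minimum distance of a linear code of length `n`, i.e. the least Hamming weight of a nonzero
codeword. (Meaningful only when the code has a nonzero codeword.) -/
noncomputable def minDist {F : Type*} [Field F] {n : ℕ} (C : Submodule F (Fin n → F)) : ℕ :=
  open Classical in sInf {w : ℕ | ∃ c ∈ C, c ≠ 0 ∧ hammingNorm c = w}

/-- `C` is an `(n, k, r, t)` (all-symbol) availability code: an `[n, k]` linear code such that every
code symbol `c_i` has `t` pairwise disjoint recovery sets of size at most `r`, none containing `i`,
from each of which `c_i` can be expressed linearly. -/
def IsAvailabilityCode {F : Type*} [Field F] {n : ℕ} (C : Submodule F (Fin n → F))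
    (k r t : ℕ) : Prop :=
  Module.finrank F C = k ∧
    ∀ i : Fin n, ∃ R : Fin t → Finset (Fin n),
      (∀ j j' : Fin t, j ≠ j' → Disjoint (R j) (R j')) ∧
      ∀ j : Fin t, i ∉ R j ∧ (R j).card ≤ r ∧
        ∃ a : Fin n → F, ∀ c ∈ C, c i = ∑ l ∈ R j, a l * c l

/-- `d^{(q)}(n, k)`: the maximum minimum distance of an `[n, k]` linear code over `F`.
(Here and below the sets are bounded above by `n`, so the supremum of a nonempty one is its
maximum.) -/
noncomputable def maxDist (F : Type*) [Field F] (n k : ℕ) : ℕ :=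
  sSup {d : ℕ | ∃ C : Submodule F (Fin n → F), Module.finrank F C = k ∧ minDist C = d}

/-- `k^{(q)}(n, d)`: the maximum dimension of a linear code over `F` of length `n` and minimum
distance `d`. -/
noncomputable def maxDim (F : Type*) [Field F] (n d : ℕ) : ℕ :=
  sSup {k : ℕ | ∃ C : Submodule F (Fin n → F), Module.finrank F C = k ∧ minDist C = d}

/-- `d^q_min(n, k, r, t)`: the maximum minimum distance of an `(n, k, r, t)` availability code
over the field `F`. -/
noncomputable def maxDistAvail (F : Type*) [Field F] (n k r t : ℕ) : ℕ :=
  sSup {d : ℕ | ∃ C : Submodule F (Fin n → F), IsAvailabilityCode C k r t ∧ minDist C = d}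

/-- `d_min(n, k, r, t)`: the maximum minimum distance of an `(n, k, r, t)` availability code over
any finite field. -/
noncomputable def maxDistAvailAnyField (n k r t : ℕ) : ℕ :=
  sSup {d : ℕ | ∃ (F : Type) (_ : Field F) (_ : Finite F) (C : Submodule F (Fin n → F)),
    IsAvailabilityCode C k r t ∧ minDist C = d}

/-- The dual code with respect to the standard bilinear form. -/
def dualCode {F : Type*} [Field F] {n : ℕ} (C : Submodule F (Fin n → F)) :
    Submodule F (Fin n → F) where
  carrier := {h | ∀ c ∈ C, h ⬝ᵥ c = 0}
  add_mem' := by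
    intro a b ha hb c hc
    rw [add_dotProduct, ha c hc, hb c hc, add_zero]
  zero_mem' := by
    intro c _
    exact zero_dotProduct c
  smul_mem' := by
    intro x a ha c hc
    rw [smul_dotProduct, ha c hc, smul_zero]

/-- The support of a code: the coordinates at which some codeword is nonzero. -/
def codeSupport {F : Type*} [Field F] {n : ℕ} (D : Submodule F (Fin n → F)) : Set (Fin n) :=
  {j | ∃ c ∈ D, c j ≠ 0}

/-- The `i`-th minimum support weight (generalized Hamming weight): the least support size of an
`i`-dimensional subcode; it is `⊤` if there is no such subcode. -/
noncomputable def minSupportWeight {F : Type*} [Field F] {n : ℕ} (C : Submodule F (Fin n → F))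
    (i : ℕ) : ℕ∞ :=
  ⨅ (D : Submodule F (Fin n → F)) (_ : D ≤ C ∧ Module.finrank F D = i),
    ((codeSupport D).ncard : ℕ∞)

/-- The function `ρ(r, t)` (used for `r, t ≥ 1`). -/
def rho (r t : ℕ) : ℚ :=
  if t = 1 then (r : ℚ) / (r + 1)
  else if t = 2 then (r : ℚ) / (r + 2)
  else if t = 3 then (r : ℚ) ^ 2 / ((r : ℚ) + 1) ^ 2
  else 1 / ∏ j ∈ Finset.Icc 1 t, (1 + 1 / ((j : ℚ) * r))

/-- `b₁ = ⌈n (1 - ρ(r, t))⌉`. -/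
def bOne (n r t : ℕ) : ℕ := ⌈(n : ℚ) * (1 - rho r t)⌉₊

/-- The minimum support weight sequence read from the top: `mswDown n b r m` is `e_{b-m}`. -/
def mswDown (n b r : ℕ) : ℕ → ℕ
  | 0 => n
  | m + 1 =>
      min (mswDown n b r m) (mswDown n b r m + (r + 1) - (2 * mswDown n b r m) ⌈/⌉ (b - m))

/-- The minimum support weight sequence `e_i`, `1 ≤ i ≤ b`, associated to `(n, b, r)`. -/
def mswSeq (n b r i : ℕ) : ℕ := mswDown n b r (b - i)

theorem mswSeq_top (n b r : ℕ) : mswSeq n b r b = n := by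
  simp [mswSeq, mswDown]

/-- The defining recursion `e_{i-1} = min {e_i, e_i - ⌈2 e_i / i⌉ + r + 1}`, `2 ≤ i ≤ b`, in `ℤ`
(so the subtraction of natural numbers in the definition never truncates). -/
theorem mswSeq_pred (n b r i : ℕ) (hi : 2 ≤ i) (hib : i ≤ b) :
    (mswSeq n b r (i - 1) : ℤ) =
      min (mswSeq n b r i : ℤ)
        ((mswSeq n b r i : ℤ) - ⌈(2 * (mswSeq n b r i : ℚ)) / (i : ℚ)⌉ + r + 1) := by
  have h1 : b - (i - 1) = (b - i) + 1 := by omega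
  have h2 : b - (b - i) = i := by omega
  unfold mswSeq
  rw [h1, mswDown, h2]
  generalize mswDown n b r (b - i) = e
  have hc : ⌈(2 * (e : ℚ)) / (i : ℚ)⌉ = (((2 * e) ⌈/⌉ i : ℕ) : ℤ) := by
    rw [Nat.ceilDiv_eq_add_pred_div]
    rw [Int.ceil_eq_iff]
    have hi0 : (0 : ℚ) < i := by exact_mod_cast (by omega : 0 < i)
    have hdm := Nat.div_add_mod (2 * e + i - 1) i
    have hlt := Nat.mod_lt (2 * e + i - 1) (by omega : 0 < i)
    generalize (2 * e + i - 1) / i = q at *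
    generalize (2 * e + i - 1) % i = s at *
    have hz1 : ((i * q : ℕ) : ℚ) < 2 * e + i := by exact_mod_cast (by omega : i * q < 2 * e + i)
    have hz2 : (2 * e : ℚ) ≤ ((i * q : ℕ) : ℚ) := by exact_mod_cast (by omega : 2 * e ≤ i * q)
    push_cast at hz1 hz2 ⊢
    constructor
    · rw [lt_div_iff₀ hi0]; linarith
    · rw [div_le_iff₀ hi0]; linarith
  have hle : (2 * e) ⌈/⌉ i ≤ e := by
    rw [ceilDiv_le_iff_le_mul (by omega)]
    nlinarith
  rw [hc]
  push_cast [Nat.cast_sub (by omega : (2 * e) ⌈/⌉ i ≤ e + (r + 1))]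
  congr 1
  ring

/-- The index set `S = {i : e_i - i < k, 1 ≤ i ≤ b₁}`. -/
def indexSet (n k r t : ℕ) : Finset ℕ :=
  {i ∈ Finset.Icc 1 (bOne n r t) | (mswSeq n (bOne n r t) r i : ℤ) - i < k}

end AvailCode

open AvailCode

namespace AvailCode

open Finset Module

/-! Each recovery relation is a dual word of weight at most `r + 1`. A basis of the span of all such
words gives `m` parity checks whose kernel is again an availability code, of dimension `n - m`. A
rate bound for that kernel forces `m ≥ b₁` (`bOne_le_of_parityChecks`): column-weight counting for
`t ≤ 3`, a random ordering of the coordinates for `t > 3`.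

Starting from `b₁` of these checks and repeatedly discarding one with the most private columns, an
averaging argument keeps the union of the supports of `i` checks within `e_i` coordinates
(`exists_card_rowsSupport_le`). This gives the bound on support weights. Moreover, if `i`
independent dual words live on a set `E` of size `e_i`, then `C` restricted to `E` has dimension at
most `e_i - i`, so the codewords vanishing on `E` form a space of dimension at least `k + i - e_i`.
Deleting `E` from them yields a shorter availability code of no smaller distance
(`exists_shortened_mswSeq`), which gives all the comparisons. The explicit bound is a Singleton-type
argument: a set of coordinates of rank `k - 1` and large nullity is built from nested recovery sets
(`exists_closure`, `minDist_add_le`). -/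

/-- The support of a word. -/
noncomputable def wordSupport {F : Type*} [Field F] {n : ℕ} (c : Fin n → F) : Finset (Fin n) :=
  open Classical in {l | c l ≠ 0}

/-! ### Weights and supports of words. -/

section Words

variable {F : Type*} [Field F] {n : ℕ}

@[simp] theorem mem_wordSupport {c : Fin n → F} {l : Fin n} : l ∈ wordSupport c ↔ c l ≠ 0 := by
  simp [wordSupport]

theorem hammingNorm_eq_card_wordSupport [DecidableEq F] (c : Fin n → F) :
    hammingNorm c = (wordSupport c).card := by
  unfold hammingNorm
  congr 1
  ext l
  simp

theorem minDist_le_card {C : Submodule F (Fin n → F)} {c : Fin n → F} (hc : c ∈ C) (h0 : c ≠ 0) :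
    minDist C ≤ (wordSupport c).card := by
  classical
  refine Nat.sInf_le ⟨c, hc, h0, ?_⟩
  rw [← hammingNorm_eq_card_wordSupport]

theorem exists_card_eq_minDist {C : Submodule F (Fin n → F)} (hC : C ≠ ⊥) :
    ∃ c ∈ C, c ≠ 0 ∧ (wordSupport c).card = minDist C := by
  classical
  obtain ⟨c, hc, h0⟩ := C.exists_mem_ne_zero_of_ne_bot hC
  obtain ⟨c', hc', h0', hw⟩ := Nat.sInf_mem
    (s := {w : ℕ | ∃ c ∈ C, c ≠ 0 ∧ hammingNorm c = w}) ⟨_, c, hc, h0, rfl⟩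
  refine ⟨c', hc', h0', ?_⟩
  rw [← hammingNorm_eq_card_wordSupport, hw]
  unfold minDist
  congr!

theorem minDist_bot : minDist (⊥ : Submodule F (Fin n → F)) = 0 := by
  classical
  unfold minDist
  convert Nat.sInf_empty
  ext w
  simp only [Submodule.mem_bot, Set.mem_ofPred_eq, Set.mem_empty_iff_false, iff_false]
  rintro ⟨c, h, h0, -⟩
  exact h0 h

theorem minDist_le_length (C : Submodule F (Fin n → F)) : minDist C ≤ n := by
  by_cases hC : C = ⊥
  · rw [hC, minDist_bot]; exact Nat.zero_le _
  · obtain ⟨c, -, -, hw⟩ := exists_card_eq_minDist hC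
    rw [← hw]
    simpa using card_le_univ (wordSupport c)

theorem minDist_pos {C : Submodule F (Fin n → F)} (hC : C ≠ ⊥) : 1 ≤ minDist C := by
  obtain ⟨c, -, h0, hw⟩ := exists_card_eq_minDist hC
  rw [← hw, Nat.one_le_iff_ne_zero, card_ne_zero]
  obtain ⟨l, hl⟩ := Function.ne_iff.mp h0
  exact ⟨l, mem_wordSupport.mpr hl⟩

theorem ne_bot_of_finrank_pos {V : Submodule F (Fin n → F)} (h : 1 ≤ finrank F V) : V ≠ ⊥ := by
  rintro rfl
  simp at h

end Words

/-! ### Dimension counts for orthogonal complements. -/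

section Orthogonal

variable {F : Type*} [Field F] {ι α : Type*} [Fintype ι] [Fintype α]

theorem finrank_ker_mulVecLin_add_card {h : ι → α → F} (hh : LinearIndependent F h) :
    finrank F (LinearMap.ker (Matrix.of h).mulVecLin) + Fintype.card ι = Fintype.card α := by
  have h1 := LinearMap.finrank_range_add_finrank_ker (Matrix.of h).mulVecLin
  have h2 : (Matrix.of h).rank = Fintype.card ι := LinearIndependent.rank_matrix hh
  rw [Matrix.rank] at h2
  rw [finrank_pi] at h1
  omega

omit [Fintype ι] in
theorem mem_ker_mulVecLin {h : ι → α → F} {c : α → F} :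
    c ∈ LinearMap.ker (Matrix.of h).mulVecLin ↔ ∀ i, h i ⬝ᵥ c = 0 := by
  rw [LinearMap.mem_ker, Matrix.mulVecLin_apply, funext_iff]
  rfl

theorem finrank_add_card_le_of_orthogonal {h : ι → α → F} (hh : LinearIndependent F h)
    (V : Submodule F (α → F)) (hV : ∀ v ∈ V, ∀ i, h i ⬝ᵥ v = 0) :
    finrank F V + Fintype.card ι ≤ Fintype.card α := by
  rw [← finrank_ker_mulVecLin_add_card hh]
  exact Nat.add_le_add_right
    (Submodule.finrank_mono fun v hv => mem_ker_mulVecLin.mpr (hV v hv)) _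

end Orthogonal

/-! ### Local parity checks of an availability code. -/

section ParityChecks

variable {F : Type*} [Field F] {n k r t : ℕ}

/-- If `c i ≠ 0`, each of the `t` disjoint recovery sets of `i` must contain a nonzero coordinate,
and `i` itself is one more. -/
theorem IsAvailabilityCode.card_wordSupport {D : Submodule F (Fin n → F)}
    (hD : IsAvailabilityCode D k r t) {c : Fin n → F} (hc : c ∈ D) (h0 : c ≠ 0) :
    t + 1 ≤ (wordSupport c).card := by
  classical
  obtain ⟨i, hi⟩ := Function.ne_iff.mp h0
  obtain ⟨R, hdisj, hR⟩ := hD.2 i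
  have hex : ∀ j, ∃ l ∈ R j, c l ≠ 0 := by
    intro j
    obtain ⟨-, -, a, ha⟩ := hR j
    by_contra! hz
    refine hi ?_
    rw [ha c hc]
    exact sum_eq_zero fun l hl => by rw [hz l hl, mul_zero]
  choose u hu hcu using hex
  have hinj : Function.Injective u := by
    intro j j' h
    by_contra hne
    exact disjoint_left.mp (hdisj j j' hne) (hu j) (h ▸ hu j')
  have hsub : insert i (univ.image u) ⊆ wordSupport c := by
    intro l hl
    rw [mem_insert, mem_image] at hl
    rcases hl with rfl | ⟨j, -, rfl⟩
    · exact mem_wordSupport.mpr hi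
    · exact mem_wordSupport.mpr (hcu j)
  have hni : i ∉ univ.image u := by
    rw [mem_image]
    rintro ⟨j, -, hj⟩
    exact (hR j).1 (hj ▸ hu j)
  calc t + 1 = (insert i (univ.image u)).card := by
        rw [card_insert_of_notMem hni, card_image_of_injective _ hinj, card_univ, Fintype.card_fin]
    _ ≤ _ := card_le_card hsub

/-- An availability code has linearly independent parity checks of weight at most `r + 1` which
already force all the recovery relations. -/
theorem IsAvailabilityCode.exists_parityChecks {C : Submodule F (Fin n → F)}
    (hC : IsAvailabilityCode C k r t) :
    ∃ (m : ℕ) (h : Fin m → Fin n → F), LinearIndependent F h ∧ (∀ i, h i ∈ dualCode C) ∧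
      (∀ i, (wordSupport (h i)).card ≤ r + 1) ∧
      IsAvailabilityCode (LinearMap.ker (Matrix.of h).mulVecLin) (n - m) r t := by
  classical
  set W : Set (Fin n → F) := {h | h ∈ dualCode C ∧ (wordSupport h).card ≤ r + 1}
  obtain ⟨b, hbW, hspan, hli⟩ := exists_linearIndependent F W
  have : Fintype b := hli.setFinite.fintype
  let eqv := (Fintype.equivFin b).symm
  let h : Fin (Fintype.card b) → Fin n → F := fun i => (eqv i : Fin n → F)
  have hhli : LinearIndependent F h := hli.comp _ eqv.injective
  refine ⟨Fintype.card b, h, hhli, fun i => (hbW (eqv i).2).1, fun i => (hbW (eqv i).2).2, ?_, ?_⟩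
  · have := finrank_ker_mulVecLin_add_card hhli
    simp only [Fintype.card_fin] at this
    omega
  · have hperp : ∀ c ∈ LinearMap.ker (Matrix.of h).mulVecLin, ∀ w ∈ W, w ⬝ᵥ c = 0 := by
      intro c hc w hw
      rw [mem_ker_mulVecLin] at hc
      have hw' : w ∈ Submodule.span F b := hspan ▸ Submodule.subset_span hw
      clear hw
      induction hw' using Submodule.span_induction with
      | mem x hx =>
        have := hc (eqv.symm ⟨x, hx⟩)
        simpa [h] using this
      | zero => exact zero_dotProduct c
      | add x y _ _ hx hy => rw [add_dotProduct, hx, hy, add_zero]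
      | smul a x _ hx => rw [smul_dotProduct, hx, smul_zero]
    intro i
    obtain ⟨R, hdisj, hR⟩ := hC.2 i
    refine ⟨R, hdisj, fun j => ⟨(hR j).1, (hR j).2.1, ?_⟩⟩
    obtain ⟨hij, hcard, a, ha⟩ := hR j
    refine ⟨a, fun c hc => ?_⟩
    -- The recovery relation rewritten as a dual word, supported on `i` and its recovery set.
    let w : Fin n → F := fun l => (if l = i then 1 else 0) - (if l ∈ R j then a l else 0)
    have hdot : ∀ c : Fin n → F, w ⬝ᵥ c = c i - ∑ l ∈ R j, a l * c l := by
      intro c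
      simp [w, dotProduct, sub_mul, sum_sub_distrib, ite_mul, sum_ite_mem]
    have hwW : w ∈ W := by
      refine ⟨fun c hc => ?_, ?_⟩
      · rw [hdot, ha c hc, sub_self]
      · refine (card_le_card (t := insert i (R j)) ?_).trans ((card_insert_le _ _).trans (by omega))
        intro l hl
        rw [mem_wordSupport] at hl
        by_contra hn
        rw [mem_insert, not_or] at hn
        exact hl (by simp [w, hn.1, hn.2])
    have := hperp c hc w hwW
    rw [hdot, sub_eq_zero] at this
    exact this

end ParityChecks

/-! ### Rate bounds for small `t` by counting column weights. -/

section Rate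

variable {F : Type*} [Field F] {n m r : ℕ}

/-- The rows of a parity-check matrix that meet a column. -/
noncomputable def colSupport (h : Fin m → Fin n → F) (l : Fin n) : Finset (Fin m) :=
  open Classical in {i | h i l ≠ 0}

@[simp] theorem mem_colSupport {h : Fin m → Fin n → F} {l : Fin n} {i : Fin m} :
    i ∈ colSupport h l ↔ h i l ≠ 0 := by
  simp [colSupport]

theorem sum_card_inter_colSupport (h : Fin m → Fin n → F) (T : Finset (Fin m)) :
    ∑ l, (T ∩ colSupport h l).card = ∑ i ∈ T, (wordSupport (h i)).card := by
  classical
  have := sum_card_bipartiteAbove_eq_sum_card_bipartiteBelow (s := (univ : Finset (Fin n))) (t := T)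
    (fun l i => h i l ≠ 0)
  convert this using 3 with l _ i _
  · ext i; simp [bipartiteAbove]
  · ext l; simp [bipartiteBelow]

theorem sum_card_colSupport_le {h : Fin m → Fin n → F}
    (hrow : ∀ i, (wordSupport (h i)).card ≤ r + 1) :
    ∑ l, (colSupport h l).card ≤ m * (r + 1) := by
  have := sum_card_inter_colSupport h univ
  simp only [univ_inter] at this
  rw [this]
  refine (sum_le_card_nsmul _ _ _ fun i _ => hrow i).trans ?_
  simp

/-- Minimum distance above `d` means that any `d` columns of the matrix are linearly independent. -/
theorem eq_zero_of_wordSupport_subset {h : Fin m → Fin n → F} {d : ℕ}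
    (hd : ∀ c : Fin n → F, (∀ i, h i ⬝ᵥ c = 0) → c ≠ 0 → d + 1 ≤ (wordSupport c).card)
    {S : Finset (Fin n)} (hS : S.card ≤ d) {c : Fin n → F} (hc : ∀ l ∉ S, c l = 0)
    (hz : ∀ i, h i ⬝ᵥ c = 0) : c = 0 := by
  by_contra h0
  have h1 := hd c hz h0
  have h2 : (wordSupport c).card ≤ S.card := card_le_card fun l hl => by
    by_contra hn
    exact mem_wordSupport.mp hl (hc l hn)
  omega

theorem colSupport_card_pos {h : Fin m → Fin n → F} {d : ℕ}
    (hd : ∀ c : Fin n → F, (∀ i, h i ⬝ᵥ c = 0) → c ≠ 0 → d + 1 ≤ (wordSupport c).card)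
    (h1 : 1 ≤ d) (l : Fin n) : 1 ≤ (colSupport h l).card := by
  by_contra hlt
  have he : colSupport h l = ∅ := card_eq_zero.mp (by omega)
  have hz : ∀ i, h i l = 0 := fun i => by
    by_contra hi
    exact notMem_empty i (he ▸ mem_colSupport.mpr hi)
  have := eq_zero_of_wordSupport_subset hd (S := {l}) (c := Pi.single l 1) (by simpa using h1)
    (fun l' hl' => by simp at hl'; simp [hl']) (fun i => by simp [hz i])
  simpa using congrFun this l

/-- Two weight-one columns on the same row are proportional, which would give a codeword of weight
two. -/
theorem colSupport_singleton_inj {h : Fin m → Fin n → F} {d : ℕ}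
    (hd : ∀ c : Fin n → F, (∀ i, h i ⬝ᵥ c = 0) → c ≠ 0 → d + 1 ≤ (wordSupport c).card)
    (h2 : 2 ≤ d) {l l' : Fin n} {i : Fin m} (hl : colSupport h l = {i})
    (hl' : colSupport h l' = {i}) : l = l' := by
  classical
  by_contra hne
  have hz : ∀ p, p ≠ i → h p l = 0 ∧ h p l' = 0 := fun p hp => by
    constructor <;> by_contra hn
    · have := mem_colSupport.mpr hn; rw [hl, mem_singleton] at this; exact hp this
    · have := mem_colSupport.mpr hn; rw [hl', mem_singleton] at this; exact hp this
  have hil' : h i l' ≠ 0 := mem_colSupport.mp (hl' ▸ mem_singleton_self i)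
  have := eq_zero_of_wordSupport_subset hd (S := {l, l'})
    (c := Pi.single l (h i l') - Pi.single l' (h i l)) ((card_le_two).trans h2)
    (fun p hp => by
      rw [mem_insert, mem_singleton, not_or] at hp
      simp [hp.1, hp.2])
    (fun p => by
      rw [dotProduct_sub, dotProduct_single, dotProduct_single]
      by_cases hp : p = i
      · subst hp; ring
      · simp [hz p hp])
  have hl0 := congrFun this l
  simp [hne] at hl0
  exact hil' hl0

/-- A column on rows `i`, `i'` would be a combination of the weight-one columns on these rows,
giving a codeword of weight at most three. -/
theorem colSupport_ne_pair {h : Fin m → Fin n → F} {d : ℕ}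
    (hd : ∀ c : Fin n → F, (∀ i, h i ⬝ᵥ c = 0) → c ≠ 0 → d + 1 ≤ (wordSupport c).card)
    (h3 : 3 ≤ d) {l l' l'' : Fin n} {i i' : Fin m} (hii : i ≠ i') (hl : colSupport h l = {i})
    (hl' : colSupport h l' = {i'}) : colSupport h l'' ≠ {i, i'} := by
  classical
  intro hl''
  have hz : ∀ p, p ≠ i → h p l = 0 := fun p hp => by
    by_contra hn
    have := mem_colSupport.mpr hn; rw [hl, mem_singleton] at this; exact hp this
  have hz' : ∀ p, p ≠ i' → h p l' = 0 := fun p hp => by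
    by_contra hn
    have := mem_colSupport.mpr hn; rw [hl', mem_singleton] at this; exact hp this
  have hz'' : ∀ p, p ≠ i → p ≠ i' → h p l'' = 0 := fun p hp hp' => by
    by_contra hn
    have := mem_colSupport.mpr hn
    rw [hl'', mem_insert, mem_singleton] at this
    exact this.elim hp hp'
  have hil : h i l ≠ 0 := mem_colSupport.mp (hl ▸ mem_singleton_self i)
  have hil' : h i' l' ≠ 0 := mem_colSupport.mp (hl' ▸ mem_singleton_self i')
  have hne : l'' ≠ l := by
    rintro rfl
    have : i' ∈ ({i} : Finset (Fin m)) := by rw [← hl, hl'']; simp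
    exact hii (mem_singleton.mp this).symm
  have hne' : l'' ≠ l' := by
    rintro rfl
    have : i ∈ ({i'} : Finset (Fin m)) := by rw [← hl', hl'']; simp
    exact hii (mem_singleton.mp this)
  have := eq_zero_of_wordSupport_subset hd (S := {l, l', l''})
    (c := Pi.single l'' 1 - Pi.single l (h i l'' / h i l) - Pi.single l' (h i' l'' / h i' l'))
    (card_le_three.trans h3)
    (fun p hp => by
      rw [mem_insert, mem_insert, mem_singleton, not_or, not_or] at hp
      simp [hp.1, hp.2.1, hp.2.2])
    (fun p => by
      rw [dotProduct_sub, dotProduct_sub, dotProduct_single, dotProduct_single, dotProduct_single]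
      by_cases hp : p = i
      · subst hp; rw [hz' p hii]; field_simp; ring
      · by_cases hp' : p = i'
        · subst hp'; rw [hz p hp]; field_simp; ring
        · simp [hz p hp, hz' p hp', hz'' p hp hp'])
  have hl0 := congrFun this l''
  simp [hne, hne'] at hl0

theorem length_le_of_one_le {h : Fin m → Fin n → F} {d : ℕ}
    (hrow : ∀ i, (wordSupport (h i)).card ≤ r + 1)
    (hd : ∀ c : Fin n → F, (∀ i, h i ⬝ᵥ c = 0) → c ≠ 0 → d + 1 ≤ (wordSupport c).card)
    (h1 : 1 ≤ d) : n ≤ m * (r + 1) := by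
  refine le_trans ?_ (sum_card_colSupport_le hrow)
  simpa using sum_le_sum fun (l : Fin n) (_ : l ∈ univ) => colSupport_card_pos hd h1 l

/-- The unique row meeting a column of weight one. -/
theorem exists_row_of_card_eq_one {h : Fin m → Fin n → F} {d : ℕ}
    (hd : ∀ c : Fin n → F, (∀ i, h i ⬝ᵥ c = 0) → c ≠ 0 → d + 1 ≤ (wordSupport c).card)
    (h2 : 2 ≤ d) :
    ∃ G : Finset (Fin m), G.card = ({l | (colSupport h l).card = 1} : Finset (Fin n)).card ∧
      ∀ i ∈ G, ∃ l, colSupport h l = {i} := by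
  classical
  have hex : ∀ l ∈ ({l | (colSupport h l).card = 1} : Finset (Fin n)),
      ∃ i, colSupport h l = {i} := fun l hl => card_eq_one.mp (mem_filter.mp hl).2
  choose row hrow using hex
  refine ⟨(univ : Finset {l // l ∈ ({l | (colSupport h l).card = 1} : Finset (Fin n))}).image
    fun l => row l.1 l.2, ?_, ?_⟩
  · rw [card_image_of_injective, card_univ, Fintype.card_coe]
    intro l l' he
    exact Subtype.ext (colSupport_singleton_inj hd h2 (hrow l.1 l.2)
      ((hrow l'.1 l'.2).trans (congrArg _ he.symm)))
  · intro i hi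
    obtain ⟨l, -, rfl⟩ := mem_image.mp hi
    exact ⟨l, hrow l.1 l.2⟩

/-- Weight-one columns occupy distinct rows, so there are at most `m` of them; every other column
has weight at least two. -/
theorem length_le_of_two_le {h : Fin m → Fin n → F} {d : ℕ}
    (hrow : ∀ i, (wordSupport (h i)).card ≤ r + 1)
    (hd : ∀ c : Fin n → F, (∀ i, h i ⬝ᵥ c = 0) → c ≠ 0 → d + 1 ≤ (wordSupport c).card)
    (h2 : 2 ≤ d) : 2 * n ≤ m * (r + 2) := by
  classical
  obtain ⟨G, hG, -⟩ := exists_row_of_card_eq_one hd h2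
  have hGm : G.card ≤ m := by simpa using card_le_univ G
  have hsum : ∑ l : Fin n, 2 ≤
      ∑ l, ((colSupport h l).card + if (colSupport h l).card = 1 then 1 else 0) :=
    sum_le_sum fun l _ => by
      have := colSupport_card_pos hd (by omega) l
      split_ifs <;> omega
  rw [sum_add_distrib, ← card_filter, ← hG] at hsum
  have := sum_card_colSupport_le hrow
  simp only [sum_const, card_univ, Fintype.card_fin, smul_eq_mul] at hsum
  nlinarith

theorem length_le_of_three_le {h : Fin m → Fin n → F} {d : ℕ} (hr : 1 ≤ r)
    (hrow : ∀ i, (wordSupport (h i)).card ≤ r + 1)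
    (hd : ∀ c : Fin n → F, (∀ i, h i ⬝ᵥ c = 0) → c ≠ 0 → d + 1 ≤ (wordSupport c).card)
    (h3 : 3 ≤ d) : n * (2 * r + 1) ≤ m * (r + 1) ^ 2 := by
  classical
  obtain ⟨G, hG, hGrow⟩ := exists_row_of_card_eq_one hd (by omega : 2 ≤ d)
  have hGm : G.card ≤ m := by simpa using card_le_univ G
  set A : Finset (Fin n) := {l | (colSupport h l).card = 2} with hA
  have htot := sum_card_colSupport_le hrow
  have hsum : ∑ l : Fin n, 3 ≤
      ∑ l, ((colSupport h l).card + 2 * (if (colSupport h l).card = 1 then 1 else 0)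
        + if (colSupport h l).card = 2 then 1 else 0) :=
    sum_le_sum fun l _ => by
      have := colSupport_card_pos hd (by omega) l
      split_ifs <;> omega
  rw [sum_add_distrib, sum_add_distrib, ← mul_sum, ← card_filter, ← card_filter, ← hG, ← hA] at hsum
  have hsum' : ∑ l : Fin n, ((if (colSupport h l).card = 1 then 1 else 0)
        + 2 * if (colSupport h l).card = 2 then 1 else 0) ≤ ∑ l, (colSupport h l).card :=
    sum_le_sum fun l _ => by split_ifs <;> omega
  rw [sum_add_distrib, ← mul_sum, ← card_filter, ← card_filter, ← hG, ← hA] at hsum'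
  -- `G` is the set of rows carrying a weight-one column. A weight-two column cannot have both its
  -- rows in `G`, so it meets a row outside `G`, and these rows have at most `r + 1` entries each.
  have hAG : A.card ≤ (m - G.card) * (r + 1) := by
    calc A.card = ∑ l ∈ A, 1 := card_eq_sum_ones A
      _ ≤ ∑ l ∈ A, (Gᶜ ∩ colSupport h l).card := sum_le_sum fun l hl => by
          rw [Nat.one_le_iff_ne_zero, card_ne_zero]
          obtain ⟨i, i', hii, hl2⟩ := card_eq_two.mp (mem_filter.mp hl).2
          by_contra hn
          rw [not_nonempty_iff_eq_empty] at hn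
          have hmem : ∀ p ∈ colSupport h l, p ∈ G := fun p hp => by
            by_contra hpG
            exact notMem_empty p (hn ▸ mem_inter.mpr ⟨mem_compl.mpr hpG, hp⟩)
          obtain ⟨l₁, h₁⟩ := hGrow i (hmem i (by rw [hl2]; simp))
          obtain ⟨l₂, h₂⟩ := hGrow i' (hmem i' (by rw [hl2]; simp))
          exact colSupport_ne_pair hd h3 hii h₁ h₂ hl2
      _ ≤ ∑ l, (Gᶜ ∩ colSupport h l).card :=
          sum_le_sum_of_subset (subset_univ A)
      _ = ∑ i ∈ Gᶜ, (wordSupport (h i)).card := sum_card_inter_colSupport h Gᶜ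
      _ ≤ Gᶜ.card * (r + 1) := by
          simpa using sum_le_card_nsmul Gᶜ (fun i => (wordSupport (h i)).card) _ fun i _ => hrow i
      _ = _ := by rw [card_compl, Fintype.card_fin]
  simp only [sum_const, card_univ, Fintype.card_fin, smul_eq_mul] at hsum
  obtain ⟨q, rfl⟩ : ∃ q, r = q + 1 := ⟨r - 1, by omega⟩
  generalize G.card = g at *
  generalize A.card = a at *
  obtain ⟨p, rfl⟩ : ∃ p, m = g + p := ⟨m - g, by omega⟩
  rw [Nat.add_sub_cancel_left] at hAG
  -- With `q = r - 1`, the three inequalities `3n ≤ m(r+1) + 2g + a`, `g + 2a ≤ m(r+1)` and `a ≤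
  -- (m-g)(r+1)` are combined with weights `2r+1`, `r-1` and `3`.
  have h5 : q * (2 * a + g) ≤ q * ((g + p) * (q + 1 + 1)) :=
    Nat.mul_le_mul_left q (by omega)
  have h6 : (2 * q + 3) * (n * 3) ≤ (2 * q + 3) * ((g + p) * (q + 1 + 1) + 2 * g + a) :=
    Nat.mul_le_mul_left _ (by omega)
  nlinarith

end Rate

/-! ### Rate bound for general `t` by random labels. -/

section RandomOrder

variable {F : Type*} [Field F] {n k r t N : ℕ}

/-- Coordinates none of whose recovery sets precedes them, for the order given by a labelling,
determine the codeword. -/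
theorem finrank_le_card_unrecovered {D : Submodule F (Fin n → F)}
    {R : Fin n → Fin t → Finset (Fin n)}
    (hR : ∀ i j, ∃ a : Fin n → F, ∀ c ∈ D, c i = ∑ l ∈ R i j, a l * c l) (f : Fin n → Fin N) :
    finrank F D ≤ ({i | ∀ j, ∃ u ∈ R i j, f i ≤ f u} : Finset (Fin n)).card := by
  classical
  set S : Finset (Fin n) := {i | ∀ j, ∃ u ∈ R i j, f i ≤ f u} with hS
  let φ : D →ₗ[F] (S → F) := (LinearMap.funLeft F F (fun l : S => (l : Fin n))) ∘ₗ D.subtype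
  have hφ : Function.Injective φ := by
    rw [← LinearMap.ker_eq_bot, LinearMap.ker_eq_bot']
    rintro ⟨c, hc⟩ hz
    have hcS : ∀ l ∈ S, c l = 0 := fun l hl => congrFun hz ⟨l, hl⟩
    have hall : ∀ (x : ℕ) (i : Fin n), (f i : ℕ) = x → c i = 0 := by
      intro x
      induction x using Nat.strong_induction_on with
      | _ x ih =>
        intro i hi
        by_cases hiS : i ∈ S
        · exact hcS i hiS
        · simp only [hS, mem_filter, mem_univ, true_and, not_forall, not_exists, not_and,
            not_le] at hiS
          obtain ⟨j, hj⟩ := hiS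
          obtain ⟨a, ha⟩ := hR i j
          rw [ha c hc]
          refine sum_eq_zero fun l hl => ?_
          rw [ih (f l) (hi ▸ hj l hl) l rfl, mul_zero]
    exact Subtype.ext (funext fun i => hall _ i rfl)
  simpa using LinearMap.finrank_le_finrank_of_injective hφ

theorem prod_ite_eq_ite_mem {v : Fin n} {W : Finset (Fin n)} (hv : v ∉ W) (a : ℝ)
    (g : Fin n → ℝ) :
    ∏ u, (if u = v then a else if u ∈ W then g u else 1) = a * ∏ u ∈ W, g u := by
  classical
  have hne : ∀ u ∈ W, u ≠ v := fun u hu h => hv (h ▸ hu)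
  rw [← mul_prod_erase univ _ (mem_univ v), if_pos rfl]
  congr 1
  rw [← prod_subset (s₁ := W) (fun u hu => mem_erase.mpr ⟨hne u hu, mem_univ u⟩)
    (fun u hu hn => by rw [if_neg (mem_erase.mp hu).1, if_neg hn])]
  exact prod_congr rfl fun u hu => by rw [if_neg (hne u hu), if_pos hu]

/-- Labels of distinct coordinates are independent, so the sum over labellings factors. Up to `N ^
n`, this is the probability that `v` has label `x` and all of `W` has smaller labels. -/
theorem sum_labels_fixed {v : Fin n} {W : Finset (Fin n)} (hv : v ∉ W) (x : Fin N) :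
    ∑ f : Fin n → Fin N, (if f v = x then (1 : ℝ) else 0) * ∏ u ∈ W, (if f u < x then 1 else 0) =
      (N : ℝ) ^ n / N * ((x : ℝ) / N) ^ W.card := by
  classical
  have hN : (N : ℝ) ≠ 0 := by have := x.pos; positivity
  have h1 : ∀ f : Fin n → Fin N, (if f v = x then (1 : ℝ) else 0) *
      ∏ u ∈ W, (if f u < x then 1 else 0) = ∏ u, (if u = v then (if f u = x then (1 : ℝ) else 0)
        else if u ∈ W then (if f u < x then 1 else 0) else 1) := by
    intro f
    rw [← prod_ite_eq_ite_mem hv]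
    exact prod_congr rfl fun u _ => by split_ifs <;> simp_all
  have h2 := prod_univ_sum (fun _ : Fin n => (univ : Finset (Fin N)))
    (fun u y => (if u = v then (if y = x then (1 : ℝ) else 0)
        else if u ∈ W then (if y < x then 1 else 0) else 1))
  rw [Fintype.piFinset_univ] at h2
  simp_rw [h1]
  rw [← h2]
  have h3 : ∀ u, ∑ y : Fin N, (if u = v then (if y = x then (1 : ℝ) else 0)
        else if u ∈ W then (if y < x then 1 else 0) else 1) =
      N * (if u = v then (N : ℝ)⁻¹ else if u ∈ W then (x : ℝ) / N else 1) := by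
    intro u
    by_cases hu : u = v
    · simp [hu, hN]
    · by_cases huW : u ∈ W
      · simp only [hu, huW, if_true, if_false, sum_boole]
        have : ({y | y < x} : Finset (Fin N)).card = x := by
          rw [← Fin.card_Iio x]; congr 1; ext y; simp
        rw [this]; field_simp
      · simp [hu, huW]
  simp_rw [h3]
  rw [prod_mul_distrib, prod_const, card_univ, Fintype.card_fin, prod_ite_eq_ite_mem hv, prod_const]
  ring

theorem sum_unrecovered_fixed {v : Fin n} {R : Fin t → Finset (Fin n)} (hv : ∀ j, v ∉ R j)
    (hR : ∀ j j', j ≠ j' → Disjoint (R j) (R j')) (x : Fin N) :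
    ∑ f : Fin n → Fin N, (if f v = x then (1 : ℝ) else 0) *
        ∏ j, (1 - ∏ u ∈ R j, (if f u < x then 1 else 0)) =
      (N : ℝ) ^ n / N * ∏ j, (1 - ((x : ℝ) / N) ^ (R j).card) := by
  classical
  have hbi : ∀ T : Finset (Fin t), v ∉ T.biUnion R := by
    intro T h
    obtain ⟨j, -, hj⟩ := mem_biUnion.mp h
    exact hv j hj
  have hdis : ∀ T : Finset (Fin t), (T : Set (Fin t)).PairwiseDisjoint R :=
    fun T j _ j' _ hne => hR j j' hne
  -- Expand over subsets `T` of the recovery sets. By disjointness, each term is the previous lemma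
  -- applied to the union of the sets in `T`.
  simp_rw [prod_sub, prod_const_one, mul_one, mul_sum]
  rw [sum_comm]
  refine sum_congr rfl fun T _ => ?_
  have h := sum_labels_fixed (hbi T) x
  rw [card_biUnion fun j hj j' hj' hne => hR j j' hne, ← prod_pow_eq_pow_sum] at h
  rw [mul_left_comm, ← h, mul_sum]
  refine sum_congr rfl fun f _ => ?_
  rw [prod_biUnion (hdis T)]
  ring

theorem card_unrecovered_le {v : Fin n} {R : Fin t → Finset (Fin n)} (hv : ∀ j, v ∉ R j)
    (hR : ∀ j j', j ≠ j' → Disjoint (R j) (R j')) (hr : ∀ j, (R j).card ≤ r) :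
    (({f | ∀ j, ∃ u ∈ R j, f v ≤ f u} : Finset (Fin n → Fin N)).card : ℝ) ≤
      (N : ℝ) ^ n / N * ∑ x ∈ range N, (1 - ((x : ℝ) / N) ^ r) ^ t := by
  classical
  have h1 : (({f | ∀ j, ∃ u ∈ R j, f v ≤ f u} : Finset (Fin n → Fin N)).card : ℝ) =
      ∑ f : Fin n → Fin N, ∑ x : Fin N, (if f v = x then (1 : ℝ) else 0) *
        ∏ j, (1 - ∏ u ∈ R j, (if f u < x then 1 else 0)) := by
    rw [← sum_boole]
    refine sum_congr rfl fun f _ => ?_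
    simp only [ite_mul, one_mul, zero_mul, sum_ite_eq, mem_univ, if_true]
    split_ifs with h
    · symm
      refine prod_eq_one fun j _ => ?_
      obtain ⟨u, hu, hle⟩ := h j
      rw [prod_eq_zero hu (if_neg (not_lt.mpr hle)), sub_zero]
    · push Not at h
      obtain ⟨j, hj⟩ := h
      symm
      refine prod_eq_zero (mem_univ j) ?_
      rw [prod_eq_one fun u hu => if_pos (hj u hu), sub_self]
  rw [h1, sum_comm]
  simp_rw [sum_unrecovered_fixed hv hR]
  rw [← mul_sum, ← Fin.sum_univ_eq_sum_range (fun x : ℕ => (1 - ((x : ℝ) / N) ^ r) ^ t)]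
  refine mul_le_mul_of_nonneg_left (sum_le_sum fun x _ => ?_) (by positivity)
  have hx0 : (0 : ℝ) ≤ (x : ℝ) / N := by positivity
  have hx1 : (x : ℝ) / N ≤ 1 := by
    rw [div_le_one (by have := x.pos; positivity)]
    exact_mod_cast x.2.le
  calc ∏ j, (1 - ((x : ℝ) / N) ^ (R j).card) ≤ ∏ _j : Fin t, (1 - ((x : ℝ) / N) ^ r) :=
        prod_le_prod (fun j _ => sub_nonneg.mpr (pow_le_one₀ hx0 hx1))
          fun j _ => sub_le_sub_left (pow_le_pow_of_le_one hx0 hx1 (hr j)) 1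
    _ = _ := by simp

theorem integral_one_sub_pow_pow (hr : 1 ≤ r) (t : ℕ) :
    ∫ x in (0 : ℝ)..1, (1 - x ^ r) ^ t = 1 / ∏ j ∈ Icc 1 t, (1 + 1 / ((j : ℝ) * r)) := by
  induction t with
  | zero => simp
  | succ t ih =>
    -- Integrating this derivative over `[0, 1]`, where the boundary terms vanish, gives the
    -- recursion `(1 + (t+1)r) I_{t+1} = (t+1) r I_t`.
    have hder : ∀ x ∈ Set.uIcc (0 : ℝ) 1, HasDerivAt (fun x : ℝ => x * (1 - x ^ r) ^ (t + 1))
        ((1 + (t + 1) * r) * (1 - x ^ r) ^ (t + 1) - (t + 1) * r * (1 - x ^ r) ^ t) x := by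
      intro x _
      have h := (hasDerivAt_id x).mul ((((hasDerivAt_pow r x).const_sub 1)).pow (t + 1))
      refine HasDerivAt.congr_deriv h ?_
      obtain ⟨q, rfl⟩ : ∃ q, r = q + 1 := ⟨r - 1, by omega⟩
      simp only [id, Pi.pow_apply, Nat.add_sub_cancel]
      push_cast
      ring
    have hint := intervalIntegral.integral_eq_sub_of_hasDerivAt hder
      (Continuous.intervalIntegrable (by fun_prop) _ _)
    rw [intervalIntegral.integral_sub (Continuous.intervalIntegrable (by fun_prop) _ _)
      (Continuous.intervalIntegrable (by fun_prop) _ _),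
      intervalIntegral.integral_const_mul, intervalIntegral.integral_const_mul, ih] at hint
    have hr0 : (0 : ℝ) < r := by exact_mod_cast hr
    have hrhs : (1 : ℝ) * (1 - 1 ^ r) ^ (t + 1) - 0 * (1 - 0 ^ r) ^ (t + 1) = 0 := by simp
    rw [hrhs] at hint
    rw [prod_Icc_succ_top (by omega)]
    have hP : (0 : ℝ) < ∏ j ∈ Icc 1 t, (1 + 1 / ((j : ℝ) * r)) :=
      prod_pos fun j _ => by positivity
    set P : ℝ := ∏ j ∈ Icc 1 t, (1 + 1 / ((j : ℝ) * r))
    push_cast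
    have ht : (0 : ℝ) < (t : ℝ) + 1 := by positivity
    rw [eq_div_iff (by positivity)]
    field_simp at hint ⊢
    linarith

/-- The function is decreasing, so its right Riemann sum is below the integral; the left sum exceeds
the right one by at most the value at `0`. -/
theorem sum_range_le_integral (r t N : ℕ) (hN : 1 ≤ N) :
    ∑ x ∈ range N, (1 - ((x : ℝ) / N) ^ r) ^ t ≤
      N * (∫ x in (0 : ℝ)..1, (1 - x ^ r) ^ t) + 1 := by
  have hN0 : (0 : ℝ) < N := by exact_mod_cast hN
  set g : ℝ → ℝ := fun y => (1 - (y / N) ^ r) ^ t with hg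
  have hanti : AntitoneOn g (Set.Icc 0 (0 + (N : ℝ))) := by
    intro y hy z hz hyz
    rw [zero_add] at hy hz
    have hz1 : z / N ≤ 1 := (div_le_one hN0).mpr hz.2
    have hz0 : 0 ≤ z / N := div_nonneg hz.1 hN0.le
    have hy0 : 0 ≤ y / N := div_nonneg hy.1 hN0.le
    refine pow_le_pow_left₀ (sub_nonneg.mpr (pow_le_one₀ hz0 hz1)) (sub_le_sub_left ?_ 1) t
    exact pow_le_pow_left₀ hy0 ((div_le_div_iff_of_pos_right hN0).mpr hyz) r
  have h1 := hanti.sum_le_integral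
  have h2 : ∫ y in (0 : ℝ)..0 + N, g y = N * ∫ x in (0 : ℝ)..1, (1 - x ^ r) ^ t := by
    have := intervalIntegral.integral_comp_div (a := 0) (b := 0 + (N : ℝ))
      (fun x : ℝ => (1 - x ^ r) ^ t) hN0.ne'
    simp only [zero_add, zero_div, div_self hN0.ne', smul_eq_mul] at this
    simpa [hg] using this
  rw [h2] at h1
  have h3 := sum_range_succ (fun x : ℕ => g x) N
  have h4 := sum_range_succ' (fun x : ℕ => g x) N
  have h5 : g (0 : ℕ) ≤ 1 := by
    simp only [hg, Nat.cast_zero, zero_div]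
    rcases Nat.eq_zero_or_pos r with rfl | h
    · simpa using pow_le_one₀ (n := t) le_rfl zero_le_one
    · simp [h.ne']
  have h6 : 0 ≤ g N := by
    rcases Nat.eq_zero_or_pos t with rfl | h <;> simp [hg, hN0.ne']
  simp only [zero_add] at h1
  change ∑ x ∈ range N, g x ≤ _
  linarith

/-- The rate bound for availability codes. -/
theorem IsAvailabilityCode.dim_le {D : Submodule F (Fin n → F)}
    (hD : IsAvailabilityCode D k r t) (hr : 1 ≤ r) :
    (k : ℝ) ≤ n * (1 / ∏ j ∈ Icc 1 t, (1 + 1 / ((j : ℝ) * r))) := by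
  classical
  choose R hR using hD.2
  rw [← integral_one_sub_pow_pow hr]
  set I : ℝ := ∫ x in (0 : ℝ)..1, (1 - x ^ r) ^ t
  -- Average the number of unrecovered coordinates over all labellings. The error `n / N` disappears
  -- as `N → ∞`.
  have key : ∀ N : ℕ, 1 ≤ N → (k : ℝ) ≤ n * I + n / N := by
    intro N hN
    have hN0 : (0 : ℝ) < N := by exact_mod_cast hN
    have h1 : ∑ _f : Fin n → Fin N, (k : ℝ) ≤ ∑ f : Fin n → Fin N,
        (({i | ∀ j, ∃ u ∈ R i j, f i ≤ f u} : Finset (Fin n)).card : ℝ) :=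
      sum_le_sum fun f _ => by
        rw [← hD.1]
        exact_mod_cast finrank_le_card_unrecovered (fun i j => ((hR i).2 j).2.2) f
    have h2 : ∑ f : Fin n → Fin N, (({i | ∀ j, ∃ u ∈ R i j, f i ≤ f u} : Finset (Fin n)).card : ℝ)
        = ∑ i : Fin n, (({f | ∀ j, ∃ u ∈ R i j, f i ≤ f u} : Finset (Fin n → Fin N)).card : ℝ) := by
      simp_rw [← sum_boole]
      exact sum_comm
    have h3 : ∑ i : Fin n,
        (({f | ∀ j, ∃ u ∈ R i j, f i ≤ f u} : Finset (Fin n → Fin N)).card : ℝ) ≤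
        ∑ _i : Fin n, (N : ℝ) ^ n / N * (N * I + 1) :=
      sum_le_sum fun i _ => (card_unrecovered_le (fun j => ((hR i).2 j).1) (hR i).1
        fun j => ((hR i).2 j).2.1).trans
          (mul_le_mul_of_nonneg_left (sum_range_le_integral r t N hN) (by positivity))
    rw [h2] at h1
    have h4 := h1.trans h3
    simp only [sum_const, card_univ, Fintype.card_pi, Fintype.card_fin, prod_const, nsmul_eq_mul,
      Nat.cast_pow] at h4
    have hpow : (0 : ℝ) < (N : ℝ) ^ n := by positivity
    have h5 : (N : ℝ) ^ n * k ≤ (N : ℝ) ^ n * (n * I + n / N) := by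
      refine h4.trans (le_of_eq ?_)
      field_simp
    exact le_of_mul_le_mul_left h5 hpow
  by_contra! hlt
  obtain ⟨N, hN⟩ := exists_nat_gt ((n : ℝ) / (k - n * I))
  have hpos : 0 < (k : ℝ) - n * I := sub_pos.mpr hlt
  have hN0 : (0 : ℝ) < N := lt_of_le_of_lt (by positivity) hN
  have h := key N (by exact_mod_cast hN0)
  rw [div_lt_iff₀ hpos] at hN
  have : (n : ℝ) / N < k - n * I := by
    rw [div_lt_iff₀ hN0]; linarith
  linarith

end RandomOrder

/-- The number of independent local parity checks is at least `b₁`. -/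
theorem bOne_le_of_parityChecks {F : Type*} [Field F] {n m r t : ℕ} (hr : 1 ≤ r) (ht : 1 ≤ t)
    {h : Fin m → Fin n → F} (hrow : ∀ i, (wordSupport (h i)).card ≤ r + 1)
    (hmn : m ≤ n)
    (hD : IsAvailabilityCode (LinearMap.ker (Matrix.of h).mulVecLin) (n - m) r t) :
    bOne n r t ≤ m := by
  have hd : ∀ c : Fin n → F, (∀ i, h i ⬝ᵥ c = 0) → c ≠ 0 → t + 1 ≤ (wordSupport c).card :=
    fun c hc h0 => hD.card_wordSupport (mem_ker_mulVecLin.mpr hc) h0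
  have hr0 : (0 : ℚ) < r := by exact_mod_cast hr
  refine Nat.ceil_le.mpr ?_
  unfold rho
  split_ifs with h1 h2 h3
  · have : (n : ℚ) ≤ m * (r + 1) := by exact_mod_cast length_le_of_one_le hrow hd (by omega)
    have h' : (1 : ℚ) - r / (r + 1) = 1 / (r + 1) := by field_simp; ring
    rw [h', mul_one_div, div_le_iff₀ (by positivity)]
    exact this
  · have : 2 * (n : ℚ) ≤ m * (r + 2) := by exact_mod_cast length_le_of_two_le hrow hd (by omega)
    have h' : (1 : ℚ) - r / (r + 2) = 2 / (r + 2) := by field_simp; ring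
    rw [h', mul_div_assoc', div_le_iff₀ (by positivity)]
    linarith
  · have : (n : ℚ) * (2 * r + 1) ≤ m * (r + 1) ^ 2 := by
      exact_mod_cast length_le_of_three_le hr hrow hd (by omega)
    have h' : (1 : ℚ) - r ^ 2 / (r + 1) ^ 2 = (2 * r + 1) / (r + 1) ^ 2 := by field_simp; ring
    rw [h', mul_div_assoc', div_le_iff₀ (by positivity)]
    exact this
  · have := hD.dim_le hr
    have hq : ((n - m : ℕ) : ℚ) ≤ n * (1 / ∏ j ∈ Icc 1 t, (1 + 1 / ((j : ℚ) * r))) := by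
      rw [← Rat.cast_le (K := ℝ)]
      push_cast
      exact this
    rw [Nat.cast_sub hmn] at hq
    linarith

/-! ### Few checks with small total support. -/

section SupportSequence

variable {F : Type*} [Field F] {n m r : ℕ}

/-- The union of the supports of a set of rows. -/
noncomputable def rowsSupport (h : Fin m → Fin n → F) (T : Finset (Fin m)) : Finset (Fin n) :=
  open Classical in {l | ∃ x ∈ T, h x l ≠ 0}

@[simp] theorem mem_rowsSupport {h : Fin m → Fin n → F} {T : Finset (Fin m)} {l : Fin n} :
    l ∈ rowsSupport h T ↔ ∃ x ∈ T, h x l ≠ 0 := by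
  simp [rowsSupport]

/-- Here `p` counts the columns private to row `x`, which are lost on deleting `x`. Weights and
private columns summed over the rows count every covered column at least twice, so some row reaches
the average. -/
theorem exists_card_rowsSupport_erase_le {h : Fin m → Fin n → F}
    (hrow : ∀ i, (wordSupport (h i)).card ≤ r + 1) {T : Finset (Fin m)} (hT : T.Nonempty) :
    ∃ x ∈ T, ∃ p, (rowsSupport h (T.erase x)).card + p ≤ (rowsSupport h T).card ∧
      2 * (rowsSupport h T).card ≤ T.card * (r + 1 + p) := by
  classical
  set U := rowsSupport h T
  let P : Fin m → Finset (Fin n) := fun x => {l | T ∩ colSupport h l = {x}}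
  have h1 : ∑ l ∈ U, 2 ≤
      ∑ l ∈ U, ((T ∩ colSupport h l).card + ∑ x ∈ T, if T ∩ colSupport h l = {x} then 1 else 0) := by
    refine sum_le_sum fun l hl => ?_
    obtain ⟨x, hx, hxl⟩ := mem_rowsSupport.mp hl
    have hmem : x ∈ T ∩ colSupport h l := mem_inter.mpr ⟨hx, mem_colSupport.mpr hxl⟩
    have hpos : 0 < (T ∩ colSupport h l).card := card_pos.mpr ⟨x, hmem⟩
    by_cases hone : (T ∩ colSupport h l).card = 1
    · obtain ⟨y, hy⟩ := card_eq_one.mp hone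
      have hyT : y ∈ T := (mem_inter.mp (hy ▸ mem_singleton_self y : y ∈ T ∩ colSupport h l)).1
      have := single_le_sum (f := fun x => if T ∩ colSupport h l = {x} then 1 else 0)
        (fun _ _ => Nat.zero_le _) hyT
      simp only [hy, if_true] at this
      rw [hone, hy]
      omega
    · omega
  have h2 : ∑ l ∈ U, ((T ∩ colSupport h l).card +
      ∑ x ∈ T, if T ∩ colSupport h l = {x} then 1 else 0) ≤
      ∑ x ∈ T, ((wordSupport (h x)).card + (P x).card) := by
    refine (sum_le_sum_of_subset (subset_univ U)).trans (le_of_eq ?_)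
    rw [sum_add_distrib, sum_add_distrib, sum_card_inter_colSupport, sum_comm]
    congr 1
    exact sum_congr rfl fun x _ => (card_filter _ _).symm
  have h3 : ∑ _x ∈ T, 2 * U.card ≤
      ∑ x ∈ T, T.card * ((wordSupport (h x)).card + (P x).card) := by
    rw [← mul_sum T _ T.card, sum_const, smul_eq_mul]
    refine Nat.mul_le_mul_left _ (le_trans (le_of_eq ?_) (h1.trans h2))
    rw [sum_const, smul_eq_mul, mul_comm]
  obtain ⟨x, hx, hle⟩ := exists_le_of_sum_le hT h3
  refine ⟨x, hx, (P x).card, ?_, hle.trans (Nat.mul_le_mul_left _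
    (Nat.add_le_add_right (hrow x) _))⟩
  rw [← card_union_of_disjoint]
  · refine card_le_card (union_subset ?_ ?_)
    · intro l hl
      obtain ⟨y, hy, hyl⟩ := mem_rowsSupport.mp hl
      exact mem_rowsSupport.mpr ⟨y, mem_of_mem_erase hy, hyl⟩
    · intro l hl
      have hl' : T ∩ colSupport h l = {x} := (mem_filter.mp hl).2
      have hxl : x ∈ T ∩ colSupport h l := hl' ▸ mem_singleton_self x
      exact mem_rowsSupport.mpr ⟨x, hx, mem_colSupport.mp (mem_inter.mp hxl).2⟩
  · rw [disjoint_left]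
    intro l hl hlP
    have hl' : T ∩ colSupport h l = {x} := (mem_filter.mp hlP).2
    obtain ⟨y, hy, hyl⟩ := mem_rowsSupport.mp hl
    have : y ∈ T ∩ colSupport h l := mem_inter.mpr ⟨mem_of_mem_erase hy, mem_colSupport.mpr hyl⟩
    rw [hl', mem_singleton] at this
    exact (ne_of_mem_erase hy) this

theorem mswDown_le (n b r s : ℕ) : mswDown n b r s ≤ n := by
  induction s with
  | zero => exact le_rfl
  | succ s ih => exact (min_le_left _ _).trans ih

theorem exists_card_rowsSupport_le {h : Fin m → Fin n → F}
    (hrow : ∀ i, (wordSupport (h i)).card ≤ r + 1) {b : ℕ} (hb : b ≤ m) (s : ℕ) (hs : s < b) :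
    ∃ T : Finset (Fin m), T.card = b - s ∧ (rowsSupport h T).card ≤ mswDown n b r s := by
  classical
  induction s with
  | zero =>
    obtain ⟨T, -, hT⟩ := exists_subset_card_eq (s := (univ : Finset (Fin m))) (by simpa using hb)
    exact ⟨T, hT, by simpa [mswDown] using card_le_univ (rowsSupport h T)⟩
  | succ s ih =>
    obtain ⟨T, hT, hU⟩ := ih (by omega)
    obtain ⟨x, hx, p, hp, h2⟩ := exists_card_rowsSupport_erase_le hrow
      (card_pos.mp (by omega : 0 < T.card))
    refine ⟨T.erase x, by rw [card_erase_of_mem hx]; omega, le_min (by omega) ?_⟩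
    -- The support may be smaller than `e_i` by `δ`. Here `b - s ≥ 2`, so `⌈2e/(b-s)⌉` grows no
    -- faster than `e` and the recursion bound survives.
    obtain ⟨δ, hδ⟩ := Nat.exists_eq_add_of_le hU
    have hceil : (2 * mswDown n b r s) ⌈/⌉ (b - s) ≤ r + 1 + p + δ := by
      rw [ceilDiv_le_iff_le_mul (by omega), hδ]
      rw [hT] at h2
      have : 2 * δ ≤ (b - s) * δ := Nat.mul_le_mul_right δ (by omega)
      rw [mul_add (b - s) _ δ]
      omega
    omega

end SupportSequence

/-! ### Support weights of the dual, shortening, lowering the distance. -/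

section Dual

variable {F : Type*} [Field F] {n k r t : ℕ}

/-- The dual of an availability code contains, for `1 ≤ i ≤ b₁`, `i` independent words supported in
a set of `e_i` coordinates. -/
theorem IsAvailabilityCode.exists_dual_supported {C : Submodule F (Fin n → F)}
    (hC : IsAvailabilityCode C k r t) (hr : 1 ≤ r) (ht : 1 ≤ t) {i : ℕ} (hi : 1 ≤ i)
    (hib : i ≤ bOne n r t) :
    ∃ (E : Finset (Fin n)) (g : Fin i → Fin n → F), E.card = mswSeq n (bOne n r t) r i ∧
      LinearIndependent F g ∧ (∀ a, g a ∈ dualCode C) ∧ ∀ a, ∀ l ∉ E, g a l = 0 := by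
  obtain ⟨m, h, hli, hdual, hrow, hD⟩ := hC.exists_parityChecks
  have hmn : m ≤ n := by
    have := finrank_ker_mulVecLin_add_card hli
    simp only [Fintype.card_fin] at this
    omega
  have hbm := bOne_le_of_parityChecks hr ht hrow hmn hD
  obtain ⟨T, hT, hU⟩ := exists_card_rowsSupport_le hrow hbm (bOne n r t - i) (by omega)
  -- Pad the support to exactly `e_i` coordinates, so that shortening leaves length exactly `n -
  -- e_i`.
  obtain ⟨E, hUE, hE⟩ := exists_superset_card_eq hU (by simpa using mswDown_le _ _ _ _)
  have hTi : T.card = i := by omega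
  refine ⟨E, fun a => h (T.orderEmbOfFin hTi a), hE, hli.comp _ (T.orderEmbOfFin hTi).injective,
    fun a => hdual _, fun a l hl => ?_⟩
  by_contra hn
  exact hl (hUE (mem_rowsSupport.mpr ⟨_, T.orderEmbOfFin_mem hTi a, hn⟩))

theorem minSupportWeight_le {D : Submodule F (Fin n → F)} {i : ℕ} {E : Finset (Fin n)}
    {g : Fin i → Fin n → F} (hg : LinearIndependent F g) (hD : ∀ a, g a ∈ D)
    (hE : ∀ a, ∀ l ∉ E, g a l = 0) : minSupportWeight D i ≤ (E.card : ℕ∞) := by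
  refine (iInf₂_le (Submodule.span F (Set.range g))
    ⟨Submodule.span_le.mpr (Set.range_subset_iff.mpr hD), by simp [finrank_span_eq_card hg]⟩).trans ?_
  rw [Nat.cast_le, ← Set.ncard_coe_finset]
  refine Set.ncard_le_ncard ?_ E.finite_toSet
  rintro l ⟨c, hc, hcl⟩
  by_contra hl
  refine hcl ?_
  induction hc using Submodule.span_induction with
  | mem x hx => obtain ⟨a, rfl⟩ := hx; exact hE a l hl
  | zero => rfl
  | add x y _ _ hx hy => simp_all
  | smul a x _ hx => simp_all

theorem finrank_map_of_forall {V W : Type*} [AddCommGroup V] [Module F V] [AddCommGroup W]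
    [Module F W] (f : V →ₗ[F] W) (C : Submodule F V)
    (hf : ∀ c ∈ C, f c = 0 → c = 0) : finrank F (C.map f) = finrank F C := by
  rw [← LinearMap.range_domRestrict]
  refine LinearMap.finrank_range_of_inj ?_
  rw [← LinearMap.ker_eq_bot, LinearMap.ker_eq_bot']
  rintro ⟨c, hc⟩ h
  exact Subtype.ext (hf c hc h)

theorem exists_le_finrank_eq {V : Type*} [AddCommGroup V] [Module F V] (C : Submodule F V) {k' : ℕ}
    (hk : k' ≤ finrank F C) : ∃ C' ≤ C, finrank F C' = k' := by
  obtain ⟨f, hf⟩ := exists_linearIndependent_of_le_finrank hk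
  have hf' : LinearIndependent F fun a => (f a : V) := hf.map' C.subtype C.ker_subtype
  refine ⟨Submodule.span F (Set.range fun a => (f a : V)), ?_, by simp [finrank_span_eq_card hf']⟩
  exact Submodule.span_le.mpr (Set.range_subset_iff.mpr fun a => (f a).2)

/-- The subcode vanishing on a set `E` that supports `i` independent dual words. -/
theorem exists_vanishing_subcode {C : Submodule F (Fin n → F)} {i : ℕ}
    {E : Finset (Fin n)} {g : Fin i → Fin n → F} (hg : LinearIndependent F g)
    (hD : ∀ a, g a ∈ dualCode C) (hE : ∀ a, ∀ l ∉ E, g a l = 0) {k' : ℕ}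
    (hk : k' + E.card ≤ finrank F C + i) :
    ∃ V ≤ C, finrank F V = k' ∧ ∀ c ∈ V, ∀ l ∈ E, c l = 0 := by
  classical
  let ρ : (Fin n → F) →ₗ[F] (E → F) := LinearMap.funLeft F F (fun l : E => (l : Fin n))
  -- Each `g a` is the extension by zero of its restriction to `E`, so independence passes to the
  -- restrictions.
  have hgE : LinearIndependent F fun a => ρ (g a) := by
    refine LinearIndependent.of_comp (Function.ExtendByZero.linearMap F (fun l : E => (l : Fin n))) ?_
    convert hg using 1
    funext a l
    by_cases hl : l ∈ E
    · exact Subtype.val_injective.extend_apply (ρ (g a)) 0 (⟨l, hl⟩ : E)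
    · have : ¬ ∃ l' : E, (l' : Fin n) = l := fun ⟨l', h⟩ => hl (h ▸ l'.2)
      rw [hE a l hl]
      exact Function.extend_apply' _ _ _ this
  have h1 := finrank_add_card_le_of_orthogonal hgE (C.map ρ) (by
    rintro _ ⟨c, hc, rfl⟩ a
    rw [← hD a c hc]
    simp only [dotProduct]
    rw [← sum_subset (subset_univ E) fun l _ hl => by rw [hE a l hl, zero_mul]]
    exact sum_coe_sort E fun l => g a l * c l)
  have h2 := LinearMap.finrank_range_add_finrank_ker (ρ.domRestrict C)
  rw [LinearMap.range_domRestrict] at h2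
  have h3 := finrank_map_of_forall C.subtype (LinearMap.ker (ρ.domRestrict C))
    fun c _ h => Subtype.ext h
  simp only [Fintype.card_fin, Fintype.card_coe] at h1
  obtain ⟨V, hV, hVk⟩ := exists_le_finrank_eq ((LinearMap.ker (ρ.domRestrict C)).map C.subtype)
    (k' := k') (by omega)
  refine ⟨V, fun c hc => ?_, hVk, fun c hc l hl => ?_⟩
  · obtain ⟨c', -, rfl⟩ := hV hc
    exact c'.2
  · obtain ⟨c', hc', rfl⟩ := hV hc
    exact congrFun hc' ⟨l, hl⟩

/-- Shortening an availability code. -/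
theorem IsAvailabilityCode.exists_shortened {C V : Submodule F (Fin n → F)}
    (hC : IsAvailabilityCode C k r t) (hVC : V ≤ C) {k' : ℕ} (hV : finrank F V = k') (hk : 1 ≤ k')
    {E : Finset (Fin n)} (hE : ∀ c ∈ V, ∀ l ∈ E, c l = 0) :
    ∃ C' : Submodule F (Fin (n - E.card) → F), IsAvailabilityCode C' k' r t ∧
      minDist C ≤ minDist C' := by
  classical
  have hcard : (Eᶜ).card = n - E.card := by rw [card_compl, Fintype.card_fin]
  let g : Fin (n - E.card) ↪ Fin n := (Eᶜ.orderEmbOfFin hcard).toEmbedding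
  have hg : univ.map g = Eᶜ := by
    ext l
    rw [← mem_coe, coe_map, coe_univ, Set.image_univ, ← mem_coe]
    exact Set.ext_iff.mp (Eᶜ.range_orderEmbOfFin hcard) l
  let ρ : (Fin n → F) →ₗ[F] (Fin (n - E.card) → F) := LinearMap.funLeft F F g
  have hρ : ∀ c i, ρ c i = c (g i) := fun c i => rfl
  have hmem : ∀ l, l ∉ E → ∃ i, g i = l := by
    intro l hl
    have : l ∈ univ.map g := hg ▸ mem_compl.mpr hl
    simpa using this
  have hinj : ∀ c ∈ V, ρ c = 0 → c = 0 := by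
    intro c hc h0
    funext l
    by_cases hl : l ∈ E
    · exact hE c hc l hl
    · obtain ⟨i, rfl⟩ := hmem l hl
      exact congrFun h0 i
  have hfin : finrank F (V.map ρ) = k' := (finrank_map_of_forall ρ V hinj).trans hV
  refine ⟨V.map ρ, ⟨hfin, fun i => ?_⟩, ?_⟩
  · obtain ⟨R, hdisj, hR⟩ := hC.2 (g i)
    -- Recovery sets lose their elements in `E`; codewords vanish there, so the relations are
    -- unaffected.
    refine ⟨fun j => {l | g l ∈ R j}, fun j j' hne => ?_, fun j => ⟨?_, ?_, ?_⟩⟩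
    · rw [disjoint_left]
      intro l hl hl'
      exact disjoint_left.mp (hdisj j j' hne) (mem_filter.mp hl).2 (mem_filter.mp hl').2
    · simpa using (hR j).1
    · refine le_trans ?_ (hR j).2.1
      rw [← card_map g]
      refine card_le_card fun l hl => ?_
      obtain ⟨l', hl', rfl⟩ := mem_map.mp hl
      exact (mem_filter.mp hl').2
    · obtain ⟨a, ha⟩ := (hR j).2.2
      refine ⟨fun l => a (g l), ?_⟩
      rintro _ ⟨c, hc, rfl⟩
      simp only [hρ]
      rw [ha c (hVC hc), ← sum_map _ g fun l => a l * c l]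
      symm
      refine sum_subset (fun l hl => ?_) fun l hl hn => ?_
      · obtain ⟨l', hl', rfl⟩ := mem_map.mp hl
        exact (mem_filter.mp hl').2
      · by_cases hlE : l ∈ E
        · rw [hE c hc l hlE, mul_zero]
        · obtain ⟨l', rfl⟩ := hmem l hlE
          exact absurd (mem_map_of_mem g (mem_filter.mpr ⟨mem_univ l', hl⟩)) hn
  · obtain ⟨c', hc', h0, hw⟩ := exists_card_eq_minDist
      (ne_bot_of_finrank_pos (by omega : 1 ≤ finrank F (V.map ρ)))
    obtain ⟨c, hc, rfl⟩ := hc'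
    rw [← hw]
    refine (minDist_le_card (hVC hc) fun h => h0 (by rw [h, map_zero])).trans (le_of_eq ?_)
    rw [← card_map g]
    congr 1
    ext l
    rw [mem_wordSupport, mem_map]
    constructor
    · intro hl
      obtain ⟨i, rfl⟩ := hmem l fun h => hl (hE c hc l h)
      exact ⟨i, mem_wordSupport.mpr hl, rfl⟩
    · rintro ⟨i, hi, rfl⟩
      exact (mem_wordSupport (c := ρ c)).mp hi

/-- The minimum distance can be lowered by one without changing length and dimension. -/
theorem exists_minDist_add_one {C : Submodule F (Fin n → F)} {d : ℕ} (hd : 1 ≤ d)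
    (hC : minDist C = d + 1) :
    ∃ C' : Submodule F (Fin n → F), finrank F C' = finrank F C ∧ minDist C' = d := by
  classical
  have hbot : C ≠ ⊥ := by
    rintro rfl
    rw [minDist_bot] at hC
    omega
  obtain ⟨c, hc, h0, hw⟩ := exists_card_eq_minDist hbot
  obtain ⟨j, hj⟩ : (wordSupport c).Nonempty := card_pos.mp (by omega)
  -- Zeroing a coordinate of a minimum-weight word lowers that weight by one and no weight by more.
  -- Since `d ≥ 1`, no nonzero codeword is killed.
  let Z : (Fin n → F) →ₗ[F] (Fin n → F) :=
    { toFun := fun c l => if l = j then 0 else c l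
      map_add' := fun x y => by funext l; by_cases h : l = j <;> simp [h]
      map_smul' := fun a x => by funext l; by_cases h : l = j <;> simp [h] }
  have hZ : ∀ c, wordSupport (Z c) = (wordSupport c).erase j := by
    intro c
    ext l
    simp [Z]
  have hZ0 : ∀ c ∈ C, c ≠ 0 → d ≤ (wordSupport (Z c)).card := by
    intro c hc h0
    have := minDist_le_card hc h0
    have := pred_card_le_card_erase (s := wordSupport c) (a := j)
    rw [hZ]
    omega
  have hZinj : ∀ c ∈ C, Z c = 0 → c = 0 := by
    intro c hc hz
    by_contra h0
    have h1 := hZ0 c hc h0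
    have h2 : wordSupport (0 : Fin n → F) = ∅ := by ext l; simp
    rw [hz, h2, card_empty] at h1
    omega
  have hZc : Z c ∈ C.map Z := ⟨c, hc, rfl⟩
  have hZcne : Z c ≠ 0 := fun h => h0 (hZinj c hc h)
  refine ⟨C.map Z, finrank_map_of_forall Z C hZinj, le_antisymm ?_ ?_⟩
  · refine (minDist_le_card hZc hZcne).trans ?_
    rw [hZ, card_erase_of_mem hj]
    omega
  · obtain ⟨c', hc', h0', hw'⟩ := exists_card_eq_minDist
      (fun h => hZcne ((Submodule.mem_bot F).mp (h ▸ hZc)) : C.map Z ≠ ⊥)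
    obtain ⟨x, hx, rfl⟩ := hc'
    rw [← hw']
    exact hZ0 x hx fun h => h0' (by rw [h, map_zero])

theorem exists_minDist_eq {d : ℕ} (hd : 1 ≤ d) (s : ℕ) {C : Submodule F (Fin n → F)}
    (hC : minDist C = d + s) :
    ∃ C' : Submodule F (Fin n → F), finrank F C' = finrank F C ∧ minDist C' = d := by
  induction s generalizing C with
  | zero => exact ⟨C, rfl, hC⟩
  | succ s ih =>
    obtain ⟨C₁, h₁, h₁'⟩ := exists_minDist_add_one (by omega : 1 ≤ d + s) hC
    obtain ⟨C₂, h₂, h₂'⟩ := ih h₁'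
    exact ⟨C₂, h₂.trans h₁, h₂'⟩

end Dual

/-! ### Sets of large nullity from nested recovery sets. -/

section Closure

variable {α : Type*} [DecidableEq α] {r : ℕ}

/-- Every element of `X` has `t` disjoint recovery sets inside `X` for the rank function `rk`. -/
def RankAvailable (rk : Finset α → ℕ) (X : Finset α) (r t : ℕ) : Prop :=
  ∀ v ∈ X, ∃ R : Fin t → Finset α, (∀ j j', j ≠ j' → Disjoint (R j) (R j')) ∧
    ∀ j, R j ⊆ X ∧ v ∉ R j ∧ (R j).card ≤ r ∧ ∀ S, R j ⊆ S → rk (insert v S) = rk S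

theorem RankAvailable.pred {rk : Finset α → ℕ} {X : Finset α} {t : ℕ}
    (h : RankAvailable rk X r (t + 1)) : RankAvailable rk X r t := by
  intro v hv
  obtain ⟨R, hdisj, hR⟩ := h v hv
  exact ⟨fun j => R j.castSucc, fun j j' hne => hdisj _ _ fun h => hne (Fin.castSucc_injective t h),
    fun j => hR _⟩

/-- Deleting an element destroys at most one recovery set of every other element. -/
theorem RankAvailable.erase {rk : Finset α → ℕ} {X : Finset α} {t : ℕ}
    (h : RankAvailable rk X r (t + 1)) (w : α) : RankAvailable rk (X.erase w) r t := by
  intro v hv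
  obtain ⟨R, hdisj, hR⟩ := h v (mem_of_mem_erase hv)
  obtain ⟨p, hp⟩ : ∃ p : Fin (t + 1), ∀ j, j ≠ p → w ∉ R j := by
    by_cases hw : ∃ p, w ∈ R p
    · obtain ⟨p, hp⟩ := hw
      exact ⟨p, fun j hj hwj => disjoint_left.mp (hdisj j p hj) hwj hp⟩
    · push Not at hw
      exact ⟨0, fun j _ => hw j⟩
  refine ⟨fun j => R (p.succAbove j),
    fun j j' hne => hdisj _ _ fun h => hne (p.succAbove_right_injective h), fun j => ⟨?_, (hR _).2⟩⟩
  exact subset_erase.mpr ⟨(hR _).1, hp _ (p.succAbove_ne j)⟩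

/-- To absorb one element `v` at level `t + 1`, delete `v` (leaving level `t`), absorb the at most
`r` elements of one of its recovery sets, then add `v` back without raising the rank. The rank
budget is multiplied by `r`, and the nullity gain becomes `1 + r (1 + r + ⋯ + r ^ (t - 1))`. -/
theorem RankAvailable.exists_closure {rk : Finset α → ℕ}
    (hstep : ∀ v S, rk (insert v S) ≤ rk S + 1) (hr : 1 ≤ r) (t : ℕ) :
    ∀ (X : Finset α), RankAvailable rk X r t → ∀ (a : ℕ) (J R : Finset α), J ⊆ X → R ⊆ X →
      R.card ≤ a → rk J + a * r ^ t ≤ rk X →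
      ∃ I, J ⊆ I ∧ R ⊆ I ∧ I ⊆ X ∧ rk I ≤ rk J + a * r ^ t ∧
        J.card + rk I + a * ∑ j ∈ range t, r ^ j ≤ I.card + rk J := by
  induction t with
  | zero =>
    intro X _ a
    induction a with
    | zero =>
      intro J R hJ hR hcard _
      have : R = ∅ := card_eq_zero.mp (by omega)
      exact ⟨J, Subset.rfl, by simp [this], hJ, by omega, by simp⟩
    | succ a ih =>
      intro J R hJ hR hcard hrk
      by_cases hRJ : R ⊆ J
      · exact ⟨J, Subset.rfl, hRJ, hJ, by omega, by simp⟩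
      · obtain ⟨v, hvR, hvJ⟩ := not_subset.mp hRJ
        have h1 := hstep v J
        obtain ⟨I, h2, h3, h4, h5, h6⟩ := ih (insert v J) (R.erase v)
          (insert_subset (hR hvR) hJ) ((erase_subset v R).trans hR)
          (by rw [card_erase_of_mem hvR]; omega) (by simp only [pow_zero, mul_one] at hrk ⊢; omega)
        refine ⟨I, (subset_insert v J).trans h2, ?_, h4, ?_, ?_⟩
        · intro u hu
          by_cases huv : u = v
          · exact huv ▸ h2 (mem_insert_self v J)
          · exact h3 (mem_erase.mpr ⟨huv, hu⟩)
        · simp only [pow_zero, mul_one] at h5 ⊢; omega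
        · rw [card_insert_of_notMem hvJ] at h6
          simp only [range_zero, sum_empty, mul_zero] at h6 ⊢
          omega
  | succ t iht =>
    intro X hX a
    have single : ∀ (J : Finset α) (w : α), w ∈ X → J ⊆ X → rk J + r ^ (t + 1) ≤ rk X →
        ∃ I, J ⊆ I ∧ w ∈ I ∧ I ⊆ X ∧ rk I ≤ rk J + r ^ (t + 1) ∧
          J.card + rk I + ∑ j ∈ range (t + 1), r ^ j ≤ I.card + rk J := by
      intro J w hw hJ hrk
      have hpow : 0 < r ^ (t + 1) := Nat.pow_pos hr
      -- If `w` is already in `J`, any `v` outside `J` serves instead; one exists because `J` has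
      -- smaller rank than `X`.
      obtain ⟨v, hvX, hvJ, hvw⟩ : ∃ v ∈ X, v ∉ J ∧ (w = v ∨ w ∈ J) := by
        by_cases hwJ : w ∈ J
        · obtain ⟨v, hv, hvJ⟩ : ∃ v ∈ X, v ∉ J := by
            by_contra! hall
            rw [Subset.antisymm hJ hall] at hrk
            omega
          exact ⟨v, hv, hvJ, Or.inr hwJ⟩
        · exact ⟨w, hw, hwJ, Or.inl rfl⟩
      obtain ⟨R, -, hR⟩ := hX v hvX
      obtain ⟨hRX, hvR, hRcard, hRrk⟩ := hR 0
      -- Removing `v` keeps the rank, since a recovery set of `v` remains.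
      have hX' : rk (X.erase v) = rk X := by
        rw [← hRrk (X.erase v) (subset_erase.mpr ⟨hRX, hvR⟩), insert_erase hvX]
      obtain ⟨I, h2, h3, h4, h5, h6⟩ := iht (X.erase v) (hX.erase v) r J (R 0)
        (subset_erase.mpr ⟨hJ, hvJ⟩) (subset_erase.mpr ⟨hRX, hvR⟩) hRcard
        (by rw [hX', mul_comm, ← pow_succ]; exact hrk)
      have hvI : v ∉ I := fun h => notMem_erase v X (h4 h)
      rw [mul_comm r, ← pow_succ] at h5
      refine ⟨insert v I, h2.trans (subset_insert v I), ?_,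
        insert_subset hvX (h4.trans (erase_subset v X)), (hRrk I h3).trans_le h5, ?_⟩
      · rcases hvw with rfl | hwJ
        · exact mem_insert_self _ _
        · exact mem_insert_of_mem (h2 hwJ)
      · rw [hRrk I h3, card_insert_of_notMem hvI, sum_range_succ', pow_zero]
        simp_rw [pow_succ']
        rw [← mul_sum]
        omega
    induction a with
    | zero =>
      intro J R hJ hR hcard _
      have : R = ∅ := card_eq_zero.mp (by omega)
      exact ⟨J, Subset.rfl, by simp [this], hJ, by omega, by simp⟩
    | succ a ih =>
      intro J R hJ hR hcard hrk
      have hpow : 0 < r ^ (t + 1) := Nat.pow_pos hr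
      rw [add_mul, one_mul] at hrk
      obtain ⟨w, hw, hRw⟩ : ∃ w ∈ X, (R.erase w).card ≤ a := by
        rcases R.eq_empty_or_nonempty with rfl | ⟨w, hw⟩
        · obtain ⟨w, hw⟩ : X.Nonempty := by
            by_contra hne
            rw [not_nonempty_iff_eq_empty] at hne
            rw [hne, subset_empty] at hJ
            rw [hne, hJ] at hrk
            omega
          exact ⟨w, hw, by simp⟩
        · exact ⟨w, hR hw, by rw [card_erase_of_mem hw]; omega⟩
      obtain ⟨I₁, a1, a2, a3, a4, a5⟩ := single J w hw hJ (by omega)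
      obtain ⟨I, b1, b2, b3, b4, b5⟩ := ih I₁ (R.erase w) a3 ((erase_subset w R).trans hR) hRw
        (by omega)
      refine ⟨I, a1.trans b1, ?_, b3, ?_, ?_⟩
      · intro u hu
        by_cases huw : u = w
        · exact huw ▸ b1 a2
        · exact b2 (mem_erase.mpr ⟨huw, hu⟩)
      · rw [add_mul, one_mul]; omega
      · rw [add_mul, one_mul]; omega

/-- Matches the greedy use of a rank budget `K`: the quotient by `r ^ (t + 1)` is spent at level `t
+ 1`, the remainder at lower levels. -/
theorem sum_range_pow_mul_add_sum_div (hr : 1 ≤ r) (t K : ℕ) :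
    (K / r ^ (t + 1)) * ∑ j ∈ range (t + 1), r ^ j + ∑ j ∈ Icc 1 t, K % r ^ (t + 1) / r ^ j =
      ∑ j ∈ Icc 1 (t + 1), K / r ^ j := by
  have h1 : ∀ j ∈ Icc 1 (t + 1), K / r ^ j =
      K / r ^ (t + 1) * r ^ (t + 1 - j) + K % r ^ (t + 1) / r ^ j := by
    intro j hj
    have hj' := mem_Icc.mp hj
    have hp : r ^ (t + 1) = r ^ j * r ^ (t + 1 - j) := by rw [← pow_add]; congr 1; omega
    have hpos : 0 < r ^ j := Nat.pow_pos hr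
    conv_lhs => rw [← Nat.div_add_mod K (r ^ (t + 1))]
    generalize K / r ^ (t + 1) = q
    generalize K % r ^ (t + 1) = s
    rw [hp, mul_assoc, Nat.mul_add_div hpos, mul_comm q]
  rw [sum_congr rfl h1, sum_add_distrib, ← mul_sum]
  congr 1
  · congr 1
    refine sum_nbij' (fun j => t + 1 - j) (fun j => t + 1 - j) ?_ ?_ ?_ ?_ ?_
    all_goals
      intro j hj
      simp only [mem_range, mem_Icc] at hj ⊢
    · omega
    · omega
    · omega
    · omega
    · congr 1
      omega
  · rw [sum_Icc_succ_top (by omega), Nat.div_eq_of_lt (Nat.mod_lt K (Nat.pow_pos hr)), add_zero]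

theorem RankAvailable.exists_nullity {rk : Finset α → ℕ}
    (hstep : ∀ v S, rk (insert v S) ≤ rk S + 1) (hr : 1 ≤ r) {X : Finset α} {t : ℕ}
    (hX : RankAvailable rk X r t) {K : ℕ} {J : Finset α} (hJ : J ⊆ X) (hK : rk J + K ≤ rk X) :
    ∃ I, J ⊆ I ∧ I ⊆ X ∧ rk I ≤ rk J + K ∧
      J.card + rk I + ∑ j ∈ Icc 1 t, K / r ^ j ≤ I.card + rk J := by
  induction t generalizing K J with
  | zero => exact ⟨J, Subset.rfl, hJ, by omega, by simp⟩
  | succ t ih =>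
    have hdm := Nat.div_add_mod K (r ^ (t + 1))
    rw [mul_comm] at hdm
    obtain ⟨I₁, a1, -, a3, a4, a5⟩ := hX.exists_closure hstep hr _ _ (K / r ^ (t + 1)) J ∅ hJ
      (empty_subset X) (by simp)
      ((Nat.add_le_add_left (Nat.div_mul_le_self _ _) _).trans hK)
    obtain ⟨I, b1, b2, b3, b4⟩ := ih hX.pred (K := K % r ^ (t + 1)) a3 (by omega)
    refine ⟨I, a1.trans b1, b2, by omega, ?_⟩
    rw [← sum_range_pow_mul_add_sum_div hr]
    omega

/-- Adding elements one at a time raises the rank by at most one, so the value `K` is hit, and the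
nullity never drops. -/
theorem exists_rank_eq {rk : Finset α → ℕ} (hstep : ∀ v S, rk (insert v S) ≤ rk S + 1)
    {X : Finset α} {K : ℕ} (hK : K ≤ rk X) (s : ℕ) {J : Finset α} (hJ : J ⊆ X) (hJK : rk J ≤ K)
    (hs : X.card ≤ J.card + s) :
    ∃ I, J ⊆ I ∧ rk I = K ∧ J.card + rk I ≤ I.card + rk J := by
  induction s generalizing J with
  | zero =>
    have := eq_of_subset_of_card_le hJ hs
    subst this
    exact ⟨J, Subset.rfl, by omega, le_rfl⟩
  | succ s ih =>
    by_cases hlt : rk J = K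
    · exact ⟨J, Subset.rfl, hlt, le_rfl⟩
    · obtain ⟨v, hv, hvJ⟩ : ∃ v ∈ X, v ∉ J := by
        by_contra! hall
        rw [Subset.antisymm hJ hall] at hlt hJK
        omega
      have h1 := hstep v J
      obtain ⟨I, a1, a2, a3⟩ := ih (insert_subset hv hJ) (by omega)
        (by rw [card_insert_of_notMem hvJ]; omega)
      rw [card_insert_of_notMem hvJ] at a3
      exact ⟨I, (subset_insert v J).trans a1, a2, by omega⟩

end Closure

/-! ### Singleton-type bound with availability. -/

section DistanceBound

variable {F : Type*} [Field F] {n k r t : ℕ}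

/-- The codewords vanishing on a set of coordinates. -/
def vanishing (C : Submodule F (Fin n → F)) (S : Finset (Fin n)) : Submodule F (Fin n → F) where
  carrier := {c | c ∈ C ∧ ∀ l ∈ S, c l = 0}
  add_mem' := fun {a b} ha hb => ⟨C.add_mem ha.1 hb.1, fun l hl => by
    rw [Pi.add_apply, ha.2 l hl, hb.2 l hl, add_zero]⟩
  zero_mem' := ⟨C.zero_mem, fun _ _ => rfl⟩
  smul_mem' := fun x a ha => ⟨C.smul_mem x ha.1, fun l hl => by
    rw [Pi.smul_apply, ha.2 l hl, smul_zero]⟩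

theorem mem_vanishing {C : Submodule F (Fin n → F)} {S : Finset (Fin n)} {c : Fin n → F} :
    c ∈ vanishing C S ↔ c ∈ C ∧ ∀ l ∈ S, c l = 0 := Iff.rfl

theorem finrank_vanishing_le_insert (C : Submodule F (Fin n → F)) (v : Fin n)
    (S : Finset (Fin n)) :
    finrank F (vanishing C S) ≤ finrank F (vanishing C (insert v S)) + 1 := by
  let φ : vanishing C S →ₗ[F] F := (LinearMap.proj v).domRestrict (vanishing C S)
  have h1 := LinearMap.finrank_range_add_finrank_ker φ
  have h2 : finrank F (LinearMap.range φ) ≤ 1 := (Submodule.finrank_le _).trans (by simp)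
  have h3 : finrank F (LinearMap.ker φ) ≤ finrank F (vanishing C (insert v S)) := by
    let ψ : LinearMap.ker φ →ₗ[F] vanishing C (insert v S) :=
      LinearMap.codRestrict _ ((vanishing C S).subtype ∘ₗ (LinearMap.ker φ).subtype) fun c =>
        ⟨c.1.2.1, fun l hl => by
          rcases mem_insert.mp hl with rfl | hl
          · exact c.2
          · exact c.1.2.2 l hl⟩
    refine LinearMap.finrank_le_finrank_of_injective (f := ψ) fun x y h => ?_
    exact Subtype.ext (Subtype.ext
      (congrArg (fun z : vanishing C (insert v S) => (z : Fin n → F)) h))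
  omega

/-- The Singleton-type bound for availability codes. -/
theorem IsAvailabilityCode.minDist_add_le {C : Submodule F (Fin n → F)}
    (hC : IsAvailabilityCode C k r t) (hr : 1 ≤ r) (hk : 1 ≤ k) :
    minDist C + (k - 1) + ∑ j ∈ Icc 1 t, (k - 1) / r ^ j ≤ n := by
  classical
  -- The rank of `C` restricted to `S`, as the codimension of the subcode vanishing on `S`.
  let rk : Finset (Fin n) → ℕ := fun S => k - finrank F (vanishing C S)
  have hle : ∀ S, finrank F (vanishing C S) ≤ k := fun S => by
    rw [← hC.1]
    exact Submodule.finrank_mono fun c hc => hc.1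
  have hstep : ∀ v S, rk (insert v S) ≤ rk S + 1 := by
    intro v S
    have := finrank_vanishing_le_insert C v S
    have := hle S
    simp only [rk]
    omega
  have h0 : rk ∅ = 0 := by
    have : vanishing C ∅ = C := by ext c; simp [mem_vanishing]
    change k - finrank F (vanishing C ∅) = 0
    rw [this, hC.1, Nat.sub_self]
  have huniv : rk univ = k := by
    have : vanishing C univ = ⊥ := by
      ext c
      rw [mem_vanishing, Submodule.mem_bot]
      exact ⟨fun h => funext fun l => h.2 l (mem_univ l), fun h => by simp [h]⟩
    change k - finrank F (vanishing C univ) = k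
    rw [this, finrank_bot, Nat.sub_zero]
  have hX : RankAvailable rk univ r t := by
    intro v _
    obtain ⟨R, hdisj, hR⟩ := hC.2 v
    refine ⟨R, hdisj, fun j => ⟨subset_univ _, (hR j).1, (hR j).2.1, fun S hS => ?_⟩⟩
    obtain ⟨a, ha⟩ := (hR j).2.2
    have : vanishing C (insert v S) = vanishing C S := by
      ext c
      simp only [mem_vanishing, forall_mem_insert]
      refine ⟨fun h => ⟨h.1, h.2.2⟩, fun h => ⟨h.1, ?_, h.2⟩⟩
      rw [ha c h.1]
      exact sum_eq_zero fun l hl => by rw [h.2 l (hS hl), mul_zero]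
    change k - finrank F (vanishing C (insert v S)) = k - finrank F (vanishing C S)
    rw [this]
  obtain ⟨I₁, -, a2, a3, a4⟩ := hX.exists_nullity hstep hr (K := k - 1) (empty_subset univ)
    (by omega)
  obtain ⟨I, b1, b2, b3⟩ := exists_rank_eq hstep (X := univ) (K := k - 1) (by omega) n
    (J := I₁) a2 (by omega) (by simp)
  -- Rank `k - 1` leaves a nonzero codeword vanishing on `I`, so the distance is at most `n -
  -- I.card`.
  have hpos : 1 ≤ finrank F (vanishing C I) := by
    have : k - finrank F (vanishing C I) = k - 1 := b2
    omega
  obtain ⟨c, hc, hc0⟩ := (vanishing C I).exists_mem_ne_zero_of_ne_bot (ne_bot_of_finrank_pos hpos)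
  have hd := minDist_le_card hc.1 hc0
  have hsub : wordSupport c ⊆ Iᶜ := fun l hl => mem_compl.mpr fun h =>
    mem_wordSupport.mp hl (hc.2 l h)
  have := card_le_card hsub
  rw [card_compl, Fintype.card_fin] at this
  have hIn : I.card ≤ n := by simpa using card_le_univ I
  simp only [card_empty] at a4
  omega

end DistanceBound

/-! ### Passing to the extremal functions. -/

section Extremal

variable {F : Type*} [Field F] {n k r t : ℕ}

theorem le_maxDist {C : Submodule F (Fin n → F)} (hC : finrank F C = k) :
    minDist C ≤ maxDist F n k :=
  le_csSup ⟨n, by rintro _ ⟨C, -, rfl⟩; exact minDist_le_length C⟩ ⟨C, hC, rfl⟩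

theorem finrank_le_maxDim (C : Submodule F (Fin n → F)) :
    finrank F C ≤ maxDim F n (minDist C) :=
  le_csSup ⟨n, by rintro _ ⟨C, rfl, -⟩; simpa using C.finrank_le⟩ ⟨C, rfl, rfl⟩

theorem le_maxDistAvail {C : Submodule F (Fin n → F)} (hC : IsAvailabilityCode C k r t) :
    minDist C ≤ maxDistAvail F n k r t :=
  le_csSup ⟨n, by rintro _ ⟨C, -, rfl⟩; exact minDist_le_length C⟩ ⟨C, hC, rfl⟩

theorem le_maxDistAvailAnyField {F : Type} [Field F] [Finite F] {C : Submodule F (Fin n → F)}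
    (hC : IsAvailabilityCode C k r t) : minDist C ≤ maxDistAvailAnyField n k r t :=
  le_csSup ⟨n, by rintro _ ⟨F, _, _, C, -, rfl⟩; exact minDist_le_length C⟩
    ⟨F, inferInstance, inferInstance, C, hC, rfl⟩

theorem csSup_nat_le {s : Set ℕ} {b : ℕ} (h : ∀ d ∈ s, d ≤ b) : sSup s ≤ b := by
  rcases s.eq_empty_or_nonempty with rfl | hs
  · rw [csSup_empty]
    exact Nat.zero_le b
  · exact csSup_le hs h

theorem maxDistAvail_le_maxDist : maxDistAvail F n k r t ≤ maxDist F n k :=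
  csSup_nat_le (by rintro _ ⟨C, hC, rfl⟩; exact le_maxDist hC.1)

/-- Shortening an availability code on a set of `e_i` coordinates. -/
theorem IsAvailabilityCode.exists_shortened_mswSeq {C : Submodule F (Fin n → F)}
    (hC : IsAvailabilityCode C k r t) (hr : 1 ≤ r) (ht : 1 ≤ t) {i : ℕ} (hi : 1 ≤ i)
    (hib : i ≤ bOne n r t) (hik : mswSeq n (bOne n r t) r i < k + i) :
    ∃ C' : Submodule F (Fin (n - mswSeq n (bOne n r t) r i) → F),
      IsAvailabilityCode C' (k + i - mswSeq n (bOne n r t) r i) r t ∧ minDist C ≤ minDist C' := by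
  obtain ⟨E, g, hE, hli, hdual, hsupp⟩ := hC.exists_dual_supported hr ht hi hib
  have hCk := hC.1
  obtain ⟨V, hVC, hVk, hV⟩ := exists_vanishing_subcode hli hdual hsupp
    (k' := k + i - mswSeq n (bOne n r t) r i) (by omega)
  rw [← hE] at hVk hik ⊢
  exact hC.exists_shortened hVC hVk (by omega) hV

/-- The Singleton-type bound for availability codes in terms of floors of rationals. -/
theorem IsAvailabilityCode.minDist_le {C : Submodule F (Fin n → F)}
    (hC : IsAvailabilityCode C k r t) (hr : 1 ≤ r) (hk : 1 ≤ k) :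
    (minDist C : ℤ) ≤ (n : ℤ) - k + 1 - ∑ j ∈ Icc 1 t, ⌊((k : ℚ) - 1) / (r : ℚ) ^ j⌋ := by
  have h := hC.minDist_add_le hr hk
  have hfloor : ∀ j, ⌊((k : ℚ) - 1) / (r : ℚ) ^ j⌋ = (((k - 1) / r ^ j : ℕ) : ℤ) := by
    intro j
    have := Rat.floor_intCast_div_natCast ((k - 1 : ℕ) : ℤ) (r ^ j)
    push_cast [Nat.cast_sub hk] at this ⊢
    exact this
  simp_rw [hfloor]
  rw [← Nat.cast_sum]
  omega

theorem IsAvailabilityCode.maxDistAvailAnyField_le {C : Submodule F (Fin n → F)}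
    (hC : IsAvailabilityCode C k r t) (hr : 1 ≤ r) (hk : 1 ≤ k) :
    (maxDistAvailAnyField n k r t : ℤ) ≤
      (n : ℤ) - k + 1 - ∑ j ∈ Icc 1 t, ⌊((k : ℚ) - 1) / (r : ℚ) ^ j⌋ := by
  -- The code `C` shows that the bound is nonnegative, so it can be compared with the supremum in
  -- `ℕ`.
  have h0 := (Int.natCast_nonneg _).trans (hC.minDist_le hr hk)
  obtain ⟨B, hB⟩ := Int.eq_ofNat_of_zero_le h0
  rw [hB, Nat.cast_le]
  refine csSup_nat_le ?_
  rintro _ ⟨F₀, _, _, C₀, hC₀, rfl⟩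
  have h := hC₀.minDist_le hr hk
  rwa [hB, Nat.cast_le] at h

end Extremal

end AvailCode

theorem mainTheorem5 {F : Type*} [Field F] [Finite F] (n k r t : ℕ)
    (hk : 1 ≤ k) (hr : 1 ≤ r) (ht : 1 ≤ t)
    (C : Submodule F (Fin n → F)) (hC : IsAvailabilityCode C k r t)
    (b : ℕ) (hb : b = bOne n r t)
    (e : ℕ → ℕ) (he : ∀ i, e i = mswSeq n b r i) :
    (∀ i ∈ Finset.Icc 1 b, minSupportWeight (dualCode C) i ≤ (e i : ℕ∞)) ∧
    (∀ i ∈ indexSet n k r t,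
      minDist C ≤ maxDistAvail F (n - e i) (k + i - e i) r t ∧
      maxDistAvail F (n - e i) (k + i - e i) r t ≤ maxDist F (n - e i) (k + i - e i)) ∧
    (∀ i ∈ Finset.Icc 1 b, (e i : ℤ) < (n : ℤ) - minDist C + 1 →
      (k : ℤ) ≤ (e i : ℤ) - i + maxDim F (n - e i) (minDist C)) ∧
    (∀ i ∈ indexSet n k r t,
      maxDistAvailAnyField n k r t ≤ maxDistAvailAnyField (n - e i) (k + i - e i) r t ∧
      (maxDistAvailAnyField (n - e i) (k + i - e i) r t : ℤ) ≤
        (n : ℤ) - k - i + 1 -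
          ∑ j ∈ Finset.Icc 1 t, ⌊((k : ℚ) + i - e i - 1) / (r : ℚ) ^ j⌋) := by
  subst hb
  have hS : ∀ i ∈ indexSet n k r t, 1 ≤ i ∧ i ≤ bOne n r t ∧
      mswSeq n (bOne n r t) r i < k + i := by
    intro i hi
    obtain ⟨h1, h2⟩ := Finset.mem_filter.mp hi
    obtain ⟨h3, h4⟩ := Finset.mem_Icc.mp h1
    exact ⟨h3, h4, by omega⟩
  refine ⟨fun i hi => ?_, fun i hi => ?_, fun i hi _ => ?_, fun i hi => ?_⟩
  · rw [he]
    obtain ⟨h3, h4⟩ := Finset.mem_Icc.mp hi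
    obtain ⟨E, g, hE, hli, hdual, hsupp⟩ := hC.exists_dual_supported hr ht h3 h4
    exact hE ▸ minSupportWeight_le hli hdual hsupp
  · rw [he]
    obtain ⟨h3, h4, h5⟩ := hS i hi
    obtain ⟨C', hC', hd⟩ := hC.exists_shortened_mswSeq hr ht h3 h4 h5
    exact ⟨hd.trans (le_maxDistAvail hC'), maxDistAvail_le_maxDist⟩
  · rw [he]
    obtain ⟨h3, h4⟩ := Finset.mem_Icc.mp hi
    -- Otherwise `k ≤ e_i - i` and the bound is immediate.
    by_cases h5 : mswSeq n (bOne n r t) r i < k + i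
    · obtain ⟨C', hC', hd⟩ := hC.exists_shortened_mswSeq hr ht h3 h4 h5
      have hpos : 1 ≤ minDist C :=
        minDist_pos (ne_bot_of_finrank_pos (hk.trans_eq hC.1.symm))
      -- `maxDim` requires distance exactly `d`, whereas shortening may increase it.
      obtain ⟨C'', hk'', hd''⟩ := exists_minDist_eq hpos (minDist C' - minDist C) (C := C')
        (by omega)
      have := finrank_le_maxDim C''
      rw [hk'', hd'', hC'.1] at this
      omega
    · omega
  · rw [he]
    obtain ⟨h3, h4, h5⟩ := hS i hi
    refine ⟨csSup_nat_le ?_, ?_⟩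
    · rintro _ ⟨F₀, _, _, C₀, hC₀, rfl⟩
      obtain ⟨C', hC', hd⟩ := hC₀.exists_shortened_mswSeq hr ht h3 h4 h5
      exact hd.trans (le_maxDistAvailAnyField hC')
    · have hen : mswSeq n (bOne n r t) r i ≤ n := mswDown_le _ _ _ _
      obtain ⟨C', hC', -⟩ := hC.exists_shortened_mswSeq hr ht h3 h4 h5
      generalize mswSeq n (bOne n r t) r i = s at h5 hen C' hC' ⊢
      have hcast : ((k + i - s : ℕ) : ℚ) = k + i - s := by
        rw [Nat.cast_sub h5.le, Nat.cast_add]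
      have h := hC'.maxDistAvailAnyField_le hr (by omega)
      rw [hcast] at h
      omega
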